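/- Let $\Omega\subset\mathbb R^d$ ($d\ge 1$) be a bounded open domain, $X=(0,1)\times\overline\Omega$, and let $\mathcal M=\mathcal M(X)\times\mathcal M(X;\mathbb R^d)$ be the space of pairs $\mu=(\rho,m)$ of bounded Borel measures. Let $\mathcal D\subset\mathcal M$ be the set of pairs with $\partial_t\rho+\operatorname{div}m=0$, i.e. $\int_X\partial_t\psi\,d\rho+\int_X\nabla\psi\cdot dm=0$ for all $\psi\in C_c^\infty(X)$ (restrictions to $X$ of functions in $C^\infty_c((0,1)\times\mathbb R^d)$). Let $\Psi(t,x)=|x|^2/(2t)$ for $t>0$, $\Psi(0,0)=0$, $\Psi=+\infty$ otherwise. For $\alpha,\beta>0$ put $B(\mu)=\int_X\Psi\big(\tfrac{d\rho}{d\lambda},\tfrac{dm}{d\lambda}\big)\,d\lambda$, where $\lambda$ is any finite positive measure with $\rho,m\ll\lambda$, and let $J_{\alpha,\beta}(\mu)=\beta B(\mu)+\alpha\|\rho\|_{\mathcal M(X)}$ if $\mu\in\mathcal D$, $J_{\alpha,\beta}(\mu)=+\infty$ otherwise. A curve $t\in[0,1]\mapsto\rho_t\in\mathcal M(\overline\Omega)$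 belongs to $C_{\rm w}$ if $t\mapsto\int g\,d\rho_t$ is continuous on $[0,1]$ for every $g\in C(\overline\Omega)$, and to $C_{\rm w}^+$ if moreover $\rho_t\ge 0$ for all $t$. Write $\rho=dt\otimes\rho_t$ if $(\rho_t)_{t\in[0,1]}$ is a Borel family with $\int_X\psi\,d\rho=\int_0^1\int_{\overline\Omega}\psi(t,x)\,d\rho_t(x)\,dt$ for all $\psi\in L^1_\rho(X)$. Let $D$ be a real Banach space, $H_t$ ($t\in[0,1]$) real Hilbert spaces, and $i_t:D\to H_t$ continuous linear maps such that $\|i_t\|\le C$ for a.e. $t$ with $C$ independent of $t$, $i_t(D)$ is dense in $H_t$ for a.e. $t$, and $t\mapsto\langle i_tx,i_ty\rangle_{H_t}$ is Lebesgue measurable for all $x,y\in D$. A map $t\mapsto f_t\in H_t$ is strongly measurable if it is the a.e. limit (in the norms of $H_t$) of a sequence of step functions $t\mapsto i_t(s_n(t))$ with $s_n:[0,1]\to D$ simple and measurable; $f\in L^2_H$ means that $f$ is strongly measurable and $\int_0^1\|f_t\|_{H_t}^2\,dt<\infty$. Let $K_t^*:\mathcal M(\overline\Omega)\to H_t$ be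 linear operators such that, for a.e. $t$, $K_t^*$ is weak*-to-weak continuous, with pre-adjoint $K_t:H_t\to C(\overline\Omega)$, and bounded with $\|K_t^*\|\le C$ for a $C$ independent of $t$; and such that $t\mapsto K_t^*\rho$ is strongly measurable for every $\rho\in\mathcal M(\overline\Omega)$. Let $f\in L^2_H$ and $(t\mapsto\tilde\rho_t)\in C_{\rm w}$, put $w_t=-K_t(K_t^*\tilde\rho_t-f_t)\in C(\overline\Omega)$ for a.e. $t$, and for $(\rho,m)\in\mathcal M$ let $\langle\rho,w\rangle=\int_0^1\int_{\overline\Omega}w_t\,d\rho_t\,dt$ if $\rho=dt\otimes\rho_t$ with $(t\mapsto\rho_t)\in C_{\rm w}$, and $\langle\rho,w\rangle=-\infty$ otherwise. Let $\varphi:\mathbb R\to[0,+\infty]$ be monotone increasing (not necessarily strictly) and lower semicontinuous, with $\varphi(0)=0$ and $\varphi(t)/t\to+\infty$ as $t\to+\infty$; put $\varphi(+\infty)=+\infty$. Then there exists $\mu^*=(\rho^*,m^*)\in\mathcal D$ that solves $$\min_{\mu=(\rho,m)\in\mathcal M}\;-\langle\rho,w\rangle+\varphi(J_{\alpha,\beta}(\mu)),$$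 and moreover $\rho^*=dt\otimes\rho^*_t$ with $(t\mapsto\rho_t^*)\in C_{\rm w}^+$. -/

import Mathlib

open MeasureTheory Set Filter Topology
open scoped ENNReal ContDiff RealInnerProductSpace

noncomputable section

namespace OTReg

/-! ### Integrals against signed measures and the weak* topology -/

section Pairing

variable {Y : Type*} [MeasurableSpace Y]

/-- The integral `∫ g dρ` of a real function against a signed measure. -/
def sint (ρ : SignedMeasure Y) (g : Y → ℝ) : ℝ :=
  VectorMeasure.integral ρ g (ContinuousLinearMap.lsmul ℝ ℝ)

variable [TopologicalSpace Y]

variable (Y) in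
/-- The weak* topology on the space of signed measures, for `Y` a compact metric space: the
coarsest topology making `ρ ↦ ∫ g dρ` continuous for all `g ∈ C(Y)`. -/
@[reducible] def weakStar : TopologicalSpace (SignedMeasure Y) :=
  ⨅ g : C(Y, ℝ), TopologicalSpace.induced (fun ρ => sint ρ g) inferInstance

variable {F : Type*} [NormedAddCommGroup F] [InnerProductSpace ℝ F]

/-- Weak*-to-weak continuity of a linear map `T : M(Y) → F`. -/
def IsWeakStarToWeakContinuous (T : SignedMeasure Y →ₗ[ℝ] F) : Prop :=
  Continuous[weakStar Y, inferInstance] (fun ρ => toWeakSpace ℝ F (T ρ))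

open Classical in
/-- The pre-adjoint `F → C(Y)` of `T : M(Y) → F`: it maps `h` to the continuous function `g` with
`⟪T ρ, h⟫ = ∫ g dρ` for all `ρ`. This function exists when `T` is weak*-to-weak continuous
(`preadjoint_spec`) and is unique (`eq_of_sint_eq`). -/
def preadjoint (T : SignedMeasure Y →ₗ[ℝ] F) (h : F) : C(Y, ℝ) :=
  if H : ∃ g : C(Y, ℝ), ∀ ρ : SignedMeasure Y, ⟪T ρ, h⟫ = sint ρ g then H.choose else 0

end Pairing

section PairingFacts

variable {Y : Type*} [TopologicalSpace Y] [CompactSpace Y] [MeasurableSpace Y] [BorelSpace Y]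

theorem isFiniteMeasure_variation {Z : Type*} [MeasurableSpace Z] (ρ : SignedMeasure Z) :
    IsFiniteMeasure ρ.variation := by
  rw [← SignedMeasure.totalVariation_eq_variation]
  infer_instance

theorem integrable_continuous (ρ : SignedMeasure Y) (g : C(Y, ℝ)) : ρ.Integrable g := by
  have := isFiniteMeasure_variation ρ
  exact Integrable.of_bound g.continuous.measurable.aestronglyMeasurable ‖g‖
    (Eventually.of_forall g.norm_coe_le_norm)

/-- `(ρ, g) ↦ ∫ g dρ` as a bilinear map. -/
def sintBilin : C(Y, ℝ) →ₗ[ℝ] SignedMeasure Y →ₗ[ℝ] ℝ :=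
  LinearMap.mk₂ ℝ (fun g ρ => sint ρ g)
    (fun g h ρ => VectorMeasure.integral_add (integrable_continuous ρ g)
      (integrable_continuous ρ h))
    (fun c _ ρ => VectorMeasure.integral_smul _ ρ _ c)
    (fun g ρ σ => VectorMeasure.integral_add_vectorMeasure (integrable_continuous ρ g)
      (integrable_continuous σ g))
    (fun c _ _ => VectorMeasure.integral_smul_vectorMeasure _ c)

theorem preadjoint_spec {F : Type*} [NormedAddCommGroup F] [InnerProductSpace ℝ F]
    {T : SignedMeasure Y →ₗ[ℝ] F} (hT : IsWeakStarToWeakContinuous T) (h : F)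
    (ρ : SignedMeasure Y) : ⟪T ρ, h⟫ = sint ρ (preadjoint T h) := by
  have H : ∃ g : C(Y, ℝ), ∀ ρ : SignedMeasure Y, ⟪T ρ, h⟫ = sint ρ g := by
    have hc : Continuous[weakStar Y, inferInstance] ((innerSL ℝ h).toLinearMap ∘ₗ T) := by
      let _ : TopologicalSpace (SignedMeasure Y) := weakStar Y
      have h1 : Continuous fun y : WeakSpace ℝ F => (topDualPairing ℝ F).flip y (innerSL ℝ h) :=
        WeakBilin.eval_continuous (topDualPairing ℝ F).flip (innerSL ℝ h)
      have h2 : Continuous fun ρ => toWeakSpace ℝ F (T ρ) := hT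
      exact h1.comp h2
    have hs := (LinearMap.mem_span_iff_continuous
      (f := fun g : C(Y, ℝ) => (sintBilin g : SignedMeasure Y →ₗ[ℝ] ℝ)) _).2 hc
    rw [show Set.range (fun g : C(Y, ℝ) => (sintBilin g : SignedMeasure Y →ₗ[ℝ] ℝ))
      = (LinearMap.range (sintBilin (Y := Y)) : Set (SignedMeasure Y →ₗ[ℝ] ℝ)) from rfl,
      Submodule.span_eq] at hs
    obtain ⟨g, hg⟩ := hs
    exact ⟨g, fun ρ => by
      rw [real_inner_comm]
      exact (LinearMap.congr_fun hg ρ).symm⟩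
  rw [preadjoint, dif_pos H]
  exact H.choose_spec ρ

end PairingFacts

theorem eq_of_sint_eq {Y : Type*} [TopologicalSpace Y] [MeasurableSpace Y] [BorelSpace Y]
    {g h : C(Y, ℝ)} (H : ∀ ρ : SignedMeasure Y, sint ρ g = sint ρ h) : g = h := by
  ext x
  have := H (VectorMeasure.dirac x 1)
  simpa [sint, VectorMeasure.integral_dirac' g.continuous.stronglyMeasurable,
    VectorMeasure.integral_dirac' h.continuous.stronglyMeasurable] using this

/-! ### Measures on the time-space cylinder -/

/-- `ℝ^d`. -/
abbrev Space (d : ℕ) := EuclideanSpace ℝ (Fin d)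

/-- The cylinder `X = (0,1) × closure Ω`. -/
abbrev Cyl {d : ℕ} (Ω : Set (Space d)) : Type := ↥(Ioo (0 : ℝ) 1) × ↥(closure Ω)

/-- Pairs `μ = (ρ, m)` of a bounded Borel measure and a bounded `ℝ^d`-valued Borel measure
on `X`. -/
abbrev Pairs {d : ℕ} (Ω : Set (Space d)) : Type :=
  SignedMeasure (Cyl Ω) × VectorMeasure (Cyl Ω) (Space d)

variable {d : ℕ} {Ω : Set (Space d)}

/-- `∂_t ρ + div m = 0` in the sense of distributions on `(0,1) × closure Ω`. The test functions
are the restrictions to the cylinder of the smooth functions with compact support in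
`(0,1) × ℝ^d` (no-flux condition on the boundary, no initial or final data). -/
def ContinuityEq (μ : Pairs Ω) : Prop :=
  ∀ ψ : ℝ × Space d → ℝ, ContDiff ℝ ∞ ψ → HasCompactSupport ψ →
    tsupport ψ ⊆ Ioo 0 1 ×ˢ univ →
    sint μ.1 (fun z => deriv (fun s : ℝ => ψ (s, z.2)) z.1)
      + VectorMeasure.integral μ.2
          (fun z => gradient (fun y : Space d => ψ (z.1, y)) z.2) (innerSL ℝ) = 0

/-- A curve `t ↦ c t ∈ M(closure Ω)` is narrowly continuous on `[0,1]` (values at other `t` are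
irrelevant). -/
def NarrowlyContinuous (c : ℝ → SignedMeasure (closure Ω)) : Prop :=
  ∀ g : C(closure Ω, ℝ), ContinuousOn (fun t => sint (c t) g) (Icc 0 1)

/-- `ρ = dt ⊗ c_t`: the family `c` is Borel on `[0,1]` and
`∫_X φ dρ = ∫_0^1 ∫ φ(t,x) dc_t(x) dt` for all `φ ∈ L¹_ρ(X)`. -/
def Disintegrates (ρ : SignedMeasure (Cyl Ω)) (c : ℝ → SignedMeasure (closure Ω)) : Prop :=
  (∀ A : Set (closure Ω), MeasurableSet A → Measurable fun t : Icc (0 : ℝ) 1 => c t A) ∧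
  ∀ φ : Cyl Ω → ℝ, ρ.Integrable φ →
    sint ρ φ =
      ∫ t : Ioo (0 : ℝ) 1, sint (c t) (fun x => φ (t, x)) ∂(volume.comap Subtype.val)

/-! ### The Benamou–Brenier energy and the regularizer -/

/-- `Ψ(t,x) = |x|²/(2t)` for `t > 0`, `Ψ(0,0) = 0`, and `+∞` otherwise. -/
def Psi (t : ℝ) (x : Space d) : ℝ≥0∞ :=
  if 0 < t then ENNReal.ofReal (‖x‖ ^ 2 / (2 * t))
  else if t = 0 ∧ x = 0 then 0 else ⊤

/-- The `i`-th component of a vector measure. -/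
def component {Y : Type*} [MeasurableSpace Y] (m : VectorMeasure Y (Space d)) (i : Fin d) :
    SignedMeasure Y :=
  m.mapRange (EuclideanSpace.proj (𝕜 := ℝ) i
    : Space d →L[ℝ] ℝ).toLinearMap.toAddMonoidHom
    (EuclideanSpace.proj (𝕜 := ℝ) i : Space d →L[ℝ] ℝ).continuous

/-- `∫_X Ψ(dρ/dΛ, dm/dΛ) dΛ`. -/
def energyWrt (Λ : Measure (Cyl Ω)) (μ : Pairs Ω) : ℝ≥0∞ :=
  ∫⁻ z, Psi (μ.1.rnDeriv Λ z)
    (WithLp.toLp 2 fun i => (component μ.2 i).rnDeriv Λ z : Space d) ∂Λ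

/-- The Benamou–Brenier energy `B(ρ,m)`. The value does not depend on the finite reference measure
dominating `ρ` and `m`; the one taken here is `|ρ| + |m|`. -/
def energyB (μ : Pairs Ω) : ℝ≥0∞ :=
  energyWrt (μ.1.variation + μ.2.variation) μ

open Classical in
/-- `J_{α,β}(μ) = β B(μ) + α ‖ρ‖` if `μ` satisfies the continuity equation, `+∞` otherwise. -/
def regJ (α β : ℝ) (μ : Pairs Ω) : ℝ≥0∞ :=
  if ContinuityEq μ then
    ENNReal.ofReal β * energyB μ + ENNReal.ofReal α * μ.1.variation univ
  else ⊤

/-! ### Time-dependent Hilbert spaces and forward operators -/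

/-- Lebesgue measure on the time interval `(0,1)`. -/
def timeMeasure : Measure ℝ := volume.restrict (Ioo 0 1)

section Sampling

variable {D : Type*} [NormedAddCommGroup D] [NormedSpace ℝ D]
  {H : ℝ → Type*} [∀ t, NormedAddCommGroup (H t)] [∀ t, InnerProductSpace ℝ (H t)]

/-- The assumptions on the maps `i_t : D → H_t`. -/
structure SamplingAssumptions (i : ∀ t, D →L[ℝ] H t) : Prop where
  bounded : ∃ C : ℝ, ∀ᵐ t ∂timeMeasure, ‖i t‖ ≤ C
  dense : ∀ᵐ t ∂timeMeasure, DenseRange (i t)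
  measurable : ∀ x y : D, AEMeasurable (fun t => ⟪i t x, i t y⟫) timeMeasure

/-- Strong measurability of a map `t ↦ f t ∈ H t`: it is the pointwise a.e. limit of step
functions `t ↦ i_t (s t)`, with `s` a simple function with values in `D`. -/
def StronglyMeas (i : ∀ t, D →L[ℝ] H t) (f : ∀ t, H t) : Prop :=
  ∃ s : ℕ → SimpleFunc ℝ D,
    ∀ᵐ t ∂timeMeasure, Tendsto (fun n => i t (s n t)) atTop (𝓝 (f t))

/-- `f ∈ L²_H = L²([0,1]; H)`. -/
def MemL2H (i : ∀ t, D →L[ℝ] H t) (f : ∀ t, H t) : Prop :=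
  StronglyMeas i f ∧ ∫⁻ t, ‖f t‖ₑ ^ 2 ∂timeMeasure < ⊤

/-- The assumptions on the linear forward operators `K_t^* : M(closure Ω) → H_t`. The second one
also contains the continuity of `K_t^*` for the total variation norm. -/
structure ForwardAssumptions (i : ∀ t, D →L[ℝ] H t)
    (Kstar : ∀ t, SignedMeasure (closure Ω) →ₗ[ℝ] H t) : Prop where
  weakStar_continuous : ∀ᵐ t ∂timeMeasure, IsWeakStarToWeakContinuous (Kstar t)
  bounded : ∃ C : ℝ, ∀ᵐ t ∂timeMeasure, ∀ ρ : SignedMeasure (closure Ω),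
    ‖Kstar t ρ‖ ≤ C * (ρ.variation univ).toReal
  stronglyMeas : ∀ ρ : SignedMeasure (closure Ω), StronglyMeas i fun t => Kstar t ρ

/-- The dual variable `w_t = -K_t (K_t^* ρ̃_t - f_t) ∈ C(closure Ω)`, with `K_t` the pre-adjoint
of `K_t^*`. -/
def dualVariable (Kstar : ∀ t, SignedMeasure (closure Ω) →ₗ[ℝ] H t)
    (ρt : ℝ → SignedMeasure (closure Ω)) (f : ∀ t, H t) (t : ℝ) : C(closure Ω, ℝ) :=
  -preadjoint (Kstar t) (Kstar t (ρt t) - f t)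

end Sampling

/-! ### The linearized problem -/

open Classical in
/-- `⟨ρ, w⟩ = ∫_0^1 ⟨ρ_t, w_t⟩ dt` if `ρ = dt ⊗ ρ_t` with `t ↦ ρ_t` narrowly continuous (such a
curve is unique on `[0,1]`), and `-∞` otherwise. -/
def timePairing (ρ : SignedMeasure (Cyl Ω)) (w : ℝ → C(closure Ω, ℝ)) : EReal :=
  if h : ∃ c : ℝ → SignedMeasure (closure Ω), Disintegrates ρ c ∧ NarrowlyContinuous c then
    ((∫ t, sint (h.choose t) (w t) ∂timeMeasure : ℝ) : EReal)
  else ⊥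

/-- The extension of `φ` by `φ(+∞) = +∞`. -/
def extendTop (φ : ℝ → ℝ≥0∞) (s : ℝ≥0∞) : ℝ≥0∞ :=
  if s = ⊤ then ⊤ else φ s.toReal

/-- `μ ↦ -⟨ρ, w⟩ + φ(J_{α,β}(μ))`, with values in `(-∞, +∞]`. -/
def objective (w : ℝ → C(closure Ω, ℝ)) (φ : ℝ → ℝ≥0∞) (α β : ℝ) (μ : Pairs Ω) : EReal :=
  -timePairing μ.1 w + (extendTop φ (regJ α β μ) : EReal)

end OTReg

end

namespace OTReg

/-! ### Integration against signed and vector measures -/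

section Pairing

variable {Y : Type*} [MeasurableSpace Y]

/-! The proof is the direct method, carried out on curves `c` instead of pairs `(ρ, m)`. The
momentum is eliminated by duality: by Young's inequality, a pair of finite energy `B` satisfies `∫
∂_tψ dρ ≤ B + ½ ∫ |∇ψ|² dρ` for every test function `ψ` (`ContinuityEq.exists_measure`). Conversely,
this family of inequalities lets Riesz representation in `L²(ρ)` produce a velocity `v` such that `m
= vρ` solves the continuity equation with energy at most `B` (`exists_velocity`,
`Admissible.exists_pair`). Since `φ` is monotone, the problem becomes the minimization of `-∫ ⟨c_t,
w_t⟩ dt + φ(βB + αM)` over `Admissible` curves of mass `M` and energy bound `B`.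

The inequalities are affine in the curve, hence stable under limits. Replacing `ψ` by its multiples
makes them quadratic, and products `η(t)G(x)` then show that `t ↦ ∫ G dc_t` is 1/2-Hölder
(`sq_sint_sub_le`); taking `G = 1` near `closure Ω` shows that the mass is constant. Equicontinuity,
a diagonal extraction and the Riesz–Markov–Kakutani theorem give compactness for bounded `M` and `B`
(`exists_limit_of_admissible`).

The dual variable has an integrable majorant `b` (`exists_integrable_bound_dualVariable`), so the
linear term is at most `M ∫ b` and passes to the limit by dominated convergence. Superlinearity of
`φ` then bounds `M` and `B` along a minimizing sequence, and lower semicontinuity of `φ` concludes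
(`exists_minimizer`). -/

theorem sint_toSignedMeasure (μ : Measure Y) [IsFiniteMeasure μ] (g : Y → ℝ) :
    sint μ.toSignedMeasure g = ∫ y, g y ∂μ := by
  have h : (ContinuousLinearMap.lsmul ℝ ℝ : ℝ →L[ℝ] ℝ →L[ℝ] ℝ)
      = (ContinuousLinearMap.lsmul ℝ ℝ).flip := by
    ext; simp
  rw [sint, h]
  exact VectorMeasure.integral_toSignedMeasure

/-- Both sides are additive in `ξ` and agree on indicators, hence on simple functions. Uniformly
bounded simple approximations and dominated convergence on each side do the rest. -/
theorem integral_withDensityᵥ {E F G : Type*} [NormedAddCommGroup E] [NormedSpace ℝ E]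
    [NormedAddCommGroup F] [NormedSpace ℝ F] [CompleteSpace F] [NormedAddCommGroup G]
    [NormedSpace ℝ G] [CompleteSpace G] (B : E →L[ℝ] F →L[ℝ] G) {μ : Measure Y} {q : Y → F}
    (hq : Integrable q μ) {ξ : Y → E} (hξ : StronglyMeasurable ξ) {C : ℝ} (hC : ∀ y, ‖ξ y‖ ≤ C) :
    VectorMeasure.integral (μ.withDensityᵥ q) ξ B = ∫ y, B (ξ y) (q y) ∂μ := by
  have hvar := Measure.variation_withDensityᵥ hq
  have hfin : IsFiniteMeasure (μ.withDensityᵥ q).variation := by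
    rw [hvar]
    exact isFiniteMeasure_withDensity hq.2.ne
  have simple : ∀ s : SimpleFunc Y E,
      VectorMeasure.integral (μ.withDensityᵥ q) s B = ∫ y, B (s y) (q y) ∂μ := by
    intro s
    have hint : ∀ s : SimpleFunc Y E, (μ.withDensityᵥ q).Integrable s := fun s =>
      SimpleFunc.integrable_of_isFiniteMeasure s
    have hint2 : ∀ s : SimpleFunc Y E, Integrable (fun y => B (s y) (q y)) μ := by
      intro s
      obtain ⟨K, hK⟩ := s.exists_forall_norm_le
      refine Integrable.mono' (hq.norm.const_mul (‖B‖ * K)) ?_ (Eventually.of_forall fun y => ?_)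
      · exact (B.aestronglyMeasurable_comp₂ s.aestronglyMeasurable hq.1)
      · refine (B.le_opNorm₂ _ _).trans ?_
        gcongr
        exact hK y
    induction s using SimpleFunc.induction with
    | const c hs =>
      rename_i s
      simp only [SimpleFunc.coe_piecewise, SimpleFunc.coe_const, Function.const_zero,
        piecewise_eq_indicator]
      have h1 : ∀ y, B (s.indicator (Function.const Y c) y) (q y)
          = s.indicator (fun y => B c (q y)) y := by
        intro y
        by_cases hy : y ∈ s <;> simp [hy]
      simp_rw [h1]
      rw [integral_indicator hs, ContinuousLinearMap.integral_comp_comm _ hq.integrableOn,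
        ← withDensityᵥ_apply hq hs, VectorMeasure.integral_indicator hs]
      simp only [Function.const_apply]
      have : IsFiniteMeasure ((μ.withDensityᵥ q).restrict s).variation := by
        rw [VectorMeasure.variation_restrict hs]; infer_instance
      erw [VectorMeasure.integral_const]
      simp [VectorMeasure.restrict_apply _ hs]
    | @add f g hfg hf hg =>
      simp only [SimpleFunc.coe_add, Pi.add_apply, map_add, _root_.add_apply]
      rw [VectorMeasure.integral_add (hint f) (hint g), hf, hg,
        integral_add (hint2 f) (hint2 g)]
  set s := hξ.approxBounded C
  have hs : ∀ y, Tendsto (fun n => s n y) atTop (𝓝 (ξ y)) := fun y =>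
    hξ.tendsto_approxBounded_of_norm_le (hC y)
  have hsC : ∀ n y, ‖s n y‖ ≤ |C| := fun n y =>
    (hξ.norm_approxBounded_le ((norm_nonneg _).trans (hC y)) n y).trans (le_abs_self C)
  have t1 : Tendsto (fun n => VectorMeasure.integral (μ.withDensityᵥ q) (s n) B) atTop
      (𝓝 (VectorMeasure.integral (μ.withDensityᵥ q) ξ B)) :=
    VectorMeasure.tendsto_integral_filter_of_norm_le_const
      (Eventually.of_forall fun n => (s n).aestronglyMeasurable)
      ⟨|C|, Eventually.of_forall fun n => Eventually.of_forall fun y => hsC n y⟩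
      (Eventually.of_forall hs)
  have t2 : Tendsto (fun n => ∫ y, B (s n y) (q y) ∂μ) atTop (𝓝 (∫ y, B (ξ y) (q y) ∂μ)) := by
    refine tendsto_integral_of_dominated_convergence (fun y => ‖B‖ * |C| * ‖q y‖)
      (fun n => B.aestronglyMeasurable_comp₂ (s n).aestronglyMeasurable hq.1)
      (hq.norm.const_mul _) (fun n => Eventually.of_forall fun y => ?_)
      (Eventually.of_forall fun y => ?_)
    · refine (B.le_opNorm₂ _ _).trans ?_
      gcongr
      exact hsC n y
    · exact ((B.flip (q y)).continuous.tendsto _).comp (hs y)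
  refine tendsto_nhds_unique t1 ?_
  simpa only [simple] using t2

theorem sint_withDensityᵥ {μ : Measure Y} {r : Y → ℝ} (hr : Integrable r μ) {g : Y → ℝ}
    (hg : Measurable g) {C : ℝ} (hC : ∀ y, |g y| ≤ C) :
    sint (μ.withDensityᵥ r) g = ∫ y, g y * r y ∂μ :=
  integral_withDensityᵥ _ hr hg.stronglyMeasurable hC

theorem abs_sint_le_of_forall_abs_le {ρ : SignedMeasure Y} {C : ℝ} {g : Y → ℝ}
    (hC : ∀ y, |g y| ≤ C) :
    |sint ρ g| ≤ C * (ρ.variation univ).toReal := by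
  have := isFiniteMeasure_variation ρ
  have h := VectorMeasure.norm_integral_le_of_norm_le_const (μ := ρ) (f := g)
    (B := ContinuousLinearMap.lsmul ℝ ℝ) (C := C) (Eventually.of_forall hC)
  -- On an empty space `C` may be negative, so that case is treated apart.
  by_cases hY : Nonempty Y
  · have hC0 : 0 ≤ C := (abs_nonneg _).trans (hC hY.some)
    refine h.trans ?_
    have h1 : ‖(ContinuousLinearMap.lsmul ℝ ℝ : ℝ →L[ℝ] ℝ →L[ℝ] ℝ)‖ ≤ 1 :=
      ContinuousLinearMap.opNorm_lsmul_le
    rw [Measure.real]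
    gcongr
    nlinarith
  · have : IsEmpty Y := not_nonempty_iff.1 hY
    simp [sint, VectorMeasure.integral_of_isEmpty, Measure.eq_zero_of_isEmpty]

end Pairing

section CompactPairing

set_option linter.unusedSectionVars false

variable {Y : Type*} [TopologicalSpace Y] [CompactSpace Y] [MeasurableSpace Y] [BorelSpace Y]

theorem sint_add (ρ : SignedMeasure Y) (g h : C(Y, ℝ)) :
    sint ρ (g + h : C(Y, ℝ)) = sint ρ g + sint ρ h :=
  LinearMap.map_add₂ sintBilin g h ρ

theorem sint_sub (ρ : SignedMeasure Y) (g h : C(Y, ℝ)) :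
    sint ρ (g - h : C(Y, ℝ)) = sint ρ g - sint ρ h :=
  LinearMap.map_sub₂ sintBilin g h ρ

theorem sint_smul (ρ : SignedMeasure Y) (a : ℝ) (g : C(Y, ℝ)) :
    sint ρ (a • g : C(Y, ℝ)) = a * sint ρ g :=
  LinearMap.map_smul₂ sintBilin a g ρ

theorem sint_neg (ρ : SignedMeasure Y) (g : C(Y, ℝ)) :
    sint ρ (-g : C(Y, ℝ)) = - sint ρ g :=
  LinearMap.map_neg₂ sintBilin g ρ

theorem abs_sint_le (ρ : SignedMeasure Y) (g : C(Y, ℝ)) :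
    |sint ρ g| ≤ ‖g‖ * (ρ.variation univ).toReal :=
  abs_sint_le_of_forall_abs_le fun y => g.norm_coe_le_norm y

theorem continuous_sint (ρ : SignedMeasure Y) : Continuous fun g : C(Y, ℝ) => sint ρ g := by
  refine continuous_iff_continuousAt.2 fun g => ?_
  rw [ContinuousAt, tendsto_iff_norm_sub_tendsto_zero]
  have h : Tendsto (fun h : C(Y, ℝ) => ‖h - g‖ * (ρ.variation univ).toReal) (𝓝 g) (𝓝 0) := by
    have : Continuous fun h : C(Y, ℝ) => ‖h - g‖ * (ρ.variation univ).toReal := by fun_prop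
    simpa using this.tendsto g
  refine squeeze_zero (fun _ => norm_nonneg _) (fun h => ?_) h
  rw [← sint_sub]
  exact abs_sint_le ρ (h - g)

/-- A functional on `C(Y)` that is nonnegative on nonnegative functions is monotone and bounded by
its value at `1`. -/
theorem abs_sint_le_of_nonneg {ρ : SignedMeasure Y}
    (hρ : ∀ g : C(Y, ℝ), 0 ≤ g → 0 ≤ sint ρ g) (g : C(Y, ℝ)) {C : ℝ} (hC : ∀ y, |g y| ≤ C) :
    |sint ρ g| ≤ C * sint ρ (1 : C(Y, ℝ)) := by
  have h1 := hρ (C • 1 - g) fun y => by simpa using (abs_le.1 (hC y)).2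
  have h2 := hρ (C • 1 + g) fun y => by simpa using neg_le_iff_add_nonneg'.1 (abs_le.1 (hC y)).1
  rw [sint_sub, sint_smul] at h1
  rw [sint_add, sint_smul] at h2
  exact abs_le.2 ⟨by linarith, by linarith⟩

/-- The Riesz–Markov–Kakutani theorem on a compact space. -/
theorem exists_measure_integral_eq [T2Space Y] (ℓ : C(Y, ℝ) →ₗ[ℝ] ℝ)
    (hℓ : ∀ g : C(Y, ℝ), 0 ≤ g → 0 ≤ ℓ g) :
    ∃ μ : Measure Y, IsFiniteMeasure μ ∧ ∀ g : C(Y, ℝ), ∫ y, g y ∂μ = ℓ g := by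
  let Λ₀ : CompactlySupportedContinuousMap Y ℝ →ₗ[ℝ] ℝ :=
    { toFun := fun g => ℓ g.toContinuousMap
      map_add' := fun g h => ℓ.map_add g.toContinuousMap h.toContinuousMap
      map_smul' := fun a g => ℓ.map_smul a g.toContinuousMap }
  let Λ : CompactlySupportedContinuousMap Y ℝ →ₚ[ℝ] ℝ :=
    PositiveLinearMap.mk₀ Λ₀ fun g hg => hℓ g.toContinuousMap hg
  refine ⟨RealRMK.rieszMeasure Λ, inferInstance, fun g => ?_⟩
  exact RealRMK.integral_rieszMeasure Λ
    ⟨g, HasCompactSupport.of_compactSpace _⟩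

end CompactPairing

/-! ### Test functions on the cylinder -/

section TestFunctions

variable {d : ℕ}

/-- The smooth functions with compact support in `(0,1) × ℝ^d`. -/
structure IsTest (ψ : ℝ × Space d → ℝ) : Prop where
  smooth : ContDiff ℝ ∞ ψ
  compact : HasCompactSupport ψ
  support : tsupport ψ ⊆ Ioo 0 1 ×ˢ univ

/-- `∂_t ψ`. -/
noncomputable def timeDeriv (ψ : ℝ × Space d → ℝ) (z : ℝ × Space d) : ℝ :=
  deriv (fun s : ℝ => ψ (s, z.2)) z.1

/-- `∇_x ψ`. -/
noncomputable def spaceGrad (ψ : ℝ × Space d → ℝ) (z : ℝ × Space d) : Space d :=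
  gradient (fun y : Space d => ψ (z.1, y)) z.2

theorem timeDeriv_eq {ψ : ℝ × Space d → ℝ} (h : Differentiable ℝ ψ) (z : ℝ × Space d) :
    timeDeriv ψ z = fderiv ℝ ψ z (1, 0) := by
  have h1 : HasDerivAt (fun s : ℝ => (s, z.2)) ((1 : ℝ), (0 : Space d)) z.1 :=
    (hasDerivAt_id z.1).prodMk (hasDerivAt_const z.1 z.2)
  exact ((h z).hasFDerivAt.comp_hasDerivAt z.1 h1).deriv

theorem spaceGrad_eq {ψ : ℝ × Space d → ℝ} (h : Differentiable ℝ ψ) (z : ℝ × Space d) :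
    spaceGrad ψ z = (InnerProductSpace.toDual ℝ (Space d)).symm
      ((fderiv ℝ ψ z).comp (ContinuousLinearMap.inr ℝ ℝ (Space d))) := by
  have h1 : HasFDerivAt (fun y : Space d => (z.1, y)) (ContinuousLinearMap.inr ℝ ℝ (Space d)) z.2 :=
    hasFDerivAt_prodMk_right z.1 z.2
  rw [spaceGrad, gradient]
  congr 1
  exact (HasFDerivAt.comp z.2 (h z).hasFDerivAt h1).fderiv

theorem timeDeriv_linear {ψ χ : ℝ × Space d → ℝ} (hψ : Differentiable ℝ ψ)
    (hχ : Differentiable ℝ χ) (a : ℝ) (z : ℝ × Space d) :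
    timeDeriv (ψ + a • χ) z = timeDeriv ψ z + a * timeDeriv χ z := by
  rw [timeDeriv_eq (hψ.add (hχ.const_smul a)), timeDeriv_eq hψ, timeDeriv_eq hχ,
    fderiv_add (hψ z) ((hχ z).const_smul a), fderiv_const_smul (hχ z)]
  simp

theorem spaceGrad_linear {ψ χ : ℝ × Space d → ℝ} (hψ : Differentiable ℝ ψ)
    (hχ : Differentiable ℝ χ) (a : ℝ) (z : ℝ × Space d) :
    spaceGrad (ψ + a • χ) z = spaceGrad ψ z + a • spaceGrad χ z := by
  rw [spaceGrad_eq (hψ.add (hχ.const_smul a)), spaceGrad_eq hψ, spaceGrad_eq hχ,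
    fderiv_add (hψ z) ((hχ z).const_smul a), fderiv_const_smul (hχ z)]
  simp [ContinuousLinearMap.add_comp, ContinuousLinearMap.smul_comp]

theorem timeDeriv_mul {η : ℝ → ℝ} (hη : Differentiable ℝ η) (G : Space d → ℝ) (z : ℝ × Space d) :
    timeDeriv (fun z => η z.1 * G z.2) z = deriv η z.1 * G z.2 := by
  change deriv (fun s => η s * G z.2) z.1 = _
  exact deriv_mul_const (hη z.1) _

theorem spaceGrad_mul (η : ℝ → ℝ) {G : Space d → ℝ} (hG : Differentiable ℝ G) (z : ℝ × Space d) :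
    spaceGrad (fun z => η z.1 * G z.2) z = η z.1 • gradient G z.2 := by
  change (InnerProductSpace.toDual ℝ (Space d)).symm (fderiv ℝ (fun y => η z.1 * G y) z.2) = _
  rw [fderiv_const_mul (hG z.2), map_smulₛₗ]
  rfl

namespace IsTest

variable {ψ χ : ℝ × Space d → ℝ}

theorem differentiable (h : IsTest ψ) : Differentiable ℝ ψ :=
  h.smooth.differentiable (by simp)

theorem continuous_fderiv (h : IsTest ψ) : Continuous (fderiv ℝ ψ) :=
  h.smooth.continuous_fderiv (by simp)

theorem continuous_timeDeriv (h : IsTest ψ) : Continuous (timeDeriv ψ) := by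
  have : timeDeriv ψ = fun z => fderiv ℝ ψ z (1, 0) := funext (timeDeriv_eq h.differentiable)
  rw [this]
  exact h.continuous_fderiv.clm_apply continuous_const

theorem continuous_spaceGrad (h : IsTest ψ) : Continuous (spaceGrad ψ) := by
  have : spaceGrad ψ = fun z => (InnerProductSpace.toDual ℝ (Space d)).symm
      ((fderiv ℝ ψ z).comp (ContinuousLinearMap.inr ℝ ℝ (Space d))) :=
    funext (spaceGrad_eq h.differentiable)
  rw [this]
  exact (LinearIsometryEquiv.continuous _).comp (h.continuous_fderiv.clm_comp continuous_const)

theorem exists_bound_timeDeriv (h : IsTest ψ) : ∃ C : ℝ, ∀ z, |timeDeriv ψ z| ≤ C := by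
  refine h.continuous_timeDeriv.bounded_above_of_compact_support ?_
  refine (h.compact.fderiv ℝ).mono fun z hz => ?_
  rw [Function.mem_support, timeDeriv_eq h.differentiable] at hz
  exact fun h0 => hz (by simp [h0])

theorem exists_bound_spaceGrad (h : IsTest ψ) : ∃ C : ℝ, ∀ z, ‖spaceGrad ψ z‖ ≤ C := by
  refine h.continuous_spaceGrad.bounded_above_of_compact_support ?_
  refine (h.compact.fderiv ℝ).mono fun z hz => ?_
  rw [Function.mem_support, spaceGrad_eq h.differentiable] at hz
  exact fun h0 => hz (by simp [h0])

theorem zero : IsTest (0 : ℝ × Space d → ℝ) :=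
  ⟨contDiff_const, HasCompactSupport.zero, by simp [tsupport]⟩

theorem linear (hψ : IsTest ψ) (hχ : IsTest χ) (a : ℝ) : IsTest (ψ + a • χ) where
  smooth := hψ.smooth.add (hχ.smooth.const_smul a)
  compact := hψ.compact.add (hχ.compact.mono (Function.support_const_smul_subset a χ))
  support := (tsupport_add ψ (a • χ)).trans (union_subset hψ.support
    ((closure_mono (Function.support_const_smul_subset a χ)).trans hχ.support))

theorem smul (hχ : IsTest χ) (a : ℝ) : IsTest (a • χ) := by
  simpa using zero.linear hχ a

theorem mul {η : ℝ → ℝ} (hη : ContDiff ℝ ∞ η) (hηc : HasCompactSupport η)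
    (hηs : tsupport η ⊆ Ioo 0 1) {G : Space d → ℝ} (hG : ContDiff ℝ ∞ G)
    (hGc : HasCompactSupport G) : IsTest fun z : ℝ × Space d => η z.1 * G z.2 := by
  have hsub : tsupport (fun z : ℝ × Space d => η z.1 * G z.2) ⊆ tsupport η ×ˢ tsupport G := by
    rw [tsupport, tsupport, tsupport, ← closure_prod_eq]
    refine closure_mono fun z hz => ?_
    exact ⟨left_ne_zero_of_mul hz, right_ne_zero_of_mul hz⟩
  refine ⟨(hη.comp contDiff_fst).mul (hG.comp contDiff_snd), ?_, ?_⟩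
  · exact (hηc.isCompact.prod hGc.isCompact).of_isClosed_subset (isClosed_tsupport _) hsub
  · exact hsub.trans (prod_mono hηs (subset_univ _))

end IsTest

theorem continuityEq_iff {Ω : Set (Space d)} {μ : Pairs Ω} :
    ContinuityEq μ ↔ ∀ ψ, IsTest ψ →
      sint μ.1 (fun z => timeDeriv ψ (z.1, z.2))
        + VectorMeasure.integral μ.2 (fun z => spaceGrad ψ (z.1, z.2)) (innerSL ℝ) = 0 :=
  ⟨fun h ψ hψ => h ψ hψ.1 hψ.2 hψ.3, fun h ψ h1 h2 h3 => h ψ ⟨h1, h2, h3⟩⟩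

end TestFunctions

/-! ### From pairs of finite energy to an inequality for the first component -/

section Energy

variable {d : ℕ}

theorem measurable_Psi : Measurable fun p : ℝ × Space d => Psi p.1 p.2 := by
  unfold Psi
  refine Measurable.ite (measurableSet_lt measurable_const measurable_fst) (by fun_prop) ?_
  refine Measurable.ite ?_ measurable_const measurable_const
  exact (measurableSet_eq_fun measurable_fst measurable_const).inter
    (measurableSet_eq_fun measurable_snd measurable_const)

theorem nonneg_of_Psi_ne_top {t : ℝ} {x : Space d} (h : Psi t x ≠ ⊤) : 0 ≤ t := by
  by_contra! ht
  simp [Psi, ht.not_gt, ht.ne] at h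

/-- Young's inequality: for `t > 0` the gap after Cauchy–Schwarz is the square `(‖x‖ - t‖ξ‖)² /
(2t)`, and for `t = 0` finiteness forces `x = 0`. -/
theorem neg_inner_le_of_Psi_ne_top {t : ℝ} {x : Space d} (h : Psi t x ≠ ⊤) (ξ : Space d) :
    -⟪ξ, x⟫ ≤ (Psi t x).toReal + 1 / 2 * (‖ξ‖ ^ 2 * t) := by
  rcases (nonneg_of_Psi_ne_top h).eq_or_lt with rfl | ht
  · have hx : x = 0 := by
      by_contra hx
      simp [Psi, hx] at h
    simp [hx]
  · have h1 : (Psi t x).toReal = ‖x‖ ^ 2 / (2 * t) := by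
      rw [Psi, if_pos ht, ENNReal.toReal_ofReal (by positivity)]
    have h2 : -⟪ξ, x⟫ ≤ ‖ξ‖ * ‖x‖ := (neg_le_abs _).trans (abs_real_inner_le_norm ξ x)
    refine h2.trans ?_
    rw [h1]
    have h3 : ‖x‖ ^ 2 / (2 * t) + 1 / 2 * (‖ξ‖ ^ 2 * t) - ‖ξ‖ * ‖x‖
        = (‖x‖ - t * ‖ξ‖) ^ 2 / (2 * t) := by
      field_simp; ring
    have h4 : 0 ≤ (‖x‖ - t * ‖ξ‖) ^ 2 / (2 * t) := by positivity
    linarith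

variable {Y : Type*} [MeasurableSpace Y]

theorem component_apply (m : VectorMeasure Y (Space d)) (i : Fin d) (s : Set Y) :
    component m i s = m s i := rfl

/-- The Euclidean norm is at most the sum of the absolute coordinates, so `|m|` is dominated by the
sum of the finite variations of the components. -/
theorem isFiniteMeasure_variation_vector (m : VectorMeasure Y (Space d)) :
    IsFiniteMeasure m.variation := by
  have h : m.variation ≤ ∑ i, (component m i).variation := by
    refine VectorMeasure.variation_le_of_forall_enorm_le fun E _ => ?_
    have h1 : ‖m E‖ₑ ≤ ∑ i, ‖m E i‖ₑ := by
      have h2 : m E = ∑ i, EuclideanSpace.single i (m E i) := by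
        ext j; simp
      calc ‖m E‖ₑ = ‖∑ i, EuclideanSpace.single i (m E i)‖ₑ := by rw [← h2]
        _ ≤ ∑ i, ‖EuclideanSpace.single i (m E i)‖ₑ := enorm_sum_le _ _
        _ = ∑ i, ‖m E i‖ₑ := by
          refine Finset.sum_congr rfl fun i _ => ?_
          rw [← ofReal_norm, ← ofReal_norm, PiLp.norm_single]
    refine h1.trans ?_
    rw [Measure.finsetSum_apply]
    exact Finset.sum_le_sum fun i _ =>
      VectorMeasure.enorm_measure_le_variation (component m i) E
  have := fun i => isFiniteMeasure_variation (component m i)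
  exact isFiniteMeasure_of_le _ h

theorem integrable_toLp {Λ : Measure Y} {f : Fin d → Y → ℝ} (hf : ∀ i, Integrable (f i) Λ) :
    Integrable (fun z => (WithLp.toLp 2 fun i => f i z : Space d)) Λ :=
  Integrable.of_eval_piLp hf

theorem withDensityᵥ_toLp_rnDeriv {Λ : Measure Y} [SigmaFinite Λ] (m : VectorMeasure Y (Space d))
    (hm : m.variation ≪ Λ) :
    Λ.withDensityᵥ (fun z => (WithLp.toLp 2 fun i => (component m i).rnDeriv Λ z : Space d))
      = m := by
  ext s hs i
  have hint : ∀ i, Integrable ((component m i).rnDeriv Λ) Λ :=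
    fun i => SignedMeasure.integrable_rnDeriv _ _
  rw [withDensityᵥ_apply (integrable_toLp hint) hs]
  have h1 := ContinuousLinearMap.integral_comp_comm
    (EuclideanSpace.proj (𝕜 := ℝ) i : Space d →L[ℝ] ℝ) ((integrable_toLp hint).integrableOn (s := s))
  refine h1.symm.trans ?_
  have hac : component m i ≪ᵥ Λ.toENNRealVectorMeasure := by
    refine VectorMeasure.AbsolutelyContinuous.mk fun t ht h0 => ?_
    rw [Measure.toENNRealVectorMeasure_apply_measurable ht] at h0
    have h2 := VectorMeasure.enorm_measure_le_variation m t
    rw [hm h0, nonpos_iff_eq_zero, enorm_eq_zero] at h2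
    rw [component_apply, h2]
    rfl
  conv_rhs => rw [← component_apply, ← SignedMeasure.withDensityᵥ_rnDeriv_eq _ _ hac]
  rw [withDensityᵥ_apply (hint i) hs]
  rfl

theorem withDensityᵥ_rnDeriv_of_variation {Λ : Measure Y} [SigmaFinite Λ] (ρ : SignedMeasure Y)
    (hρ : ρ.variation ≪ Λ) : Λ.withDensityᵥ (ρ.rnDeriv Λ) = ρ := by
  refine SignedMeasure.withDensityᵥ_rnDeriv_eq _ _ ?_
  refine VectorMeasure.AbsolutelyContinuous.mk fun t ht h0 => ?_
  rw [Measure.toENNRealVectorMeasure_apply_measurable ht] at h0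
  have h2 := VectorMeasure.enorm_measure_le_variation ρ t
  rwa [hρ h0, nonpos_iff_eq_zero, enorm_eq_zero] at h2

variable {Ω : Set (Space d)}

/-- A pair of finite energy that solves the continuity equation has a nonnegative first component,
which satisfies the dual form of the energy bound. -/
theorem ContinuityEq.exists_measure {μ : Pairs Ω} (hμ : ContinuityEq μ) (hE : energyB μ ≠ ⊤) :
    ∃ P : Measure (Cyl Ω), ∃ _ : IsFiniteMeasure P, μ.1 = P.toSignedMeasure ∧
      ∀ ψ : ℝ × Space d → ℝ, IsTest ψ → ∫ z : Cyl Ω, timeDeriv ψ (z.1, z.2) ∂P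
        ≤ (energyB μ).toReal + 1 / 2 * ∫ z : Cyl Ω, ‖spaceGrad ψ (z.1, z.2)‖ ^ 2 ∂P := by
  obtain ⟨ρ, m⟩ := μ
  have hf1 := isFiniteMeasure_variation ρ
  have hf2 := isFiniteMeasure_variation_vector m
  set Λ := ρ.variation + m.variation with hΛ
  set r := ρ.rnDeriv Λ with hr
  set q : Cyl Ω → Space d := fun z => (WithLp.toLp 2 fun i => (component m i).rnDeriv Λ z : Space d) with hq
  have hri : Integrable r Λ := SignedMeasure.integrable_rnDeriv _ _
  have hrm : Measurable r := SignedMeasure.measurable_rnDeriv _ _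
  have hqi : Integrable q Λ := integrable_toLp fun i => SignedMeasure.integrable_rnDeriv _ _
  have hqm : Measurable q := by
    refine (PiLp.continuous_toLp 2 (fun _ : Fin d => ℝ)).measurable.comp ?_
    exact measurable_pi_lambda _ fun i => SignedMeasure.measurable_rnDeriv _ _
  have hρ : Λ.withDensityᵥ r = ρ := withDensityᵥ_rnDeriv_of_variation ρ
    (Measure.absolutelyContinuous_of_le (Measure.le_add_right le_rfl))
  have hm : Λ.withDensityᵥ q = m := withDensityᵥ_toLp_rnDeriv m
    (Measure.absolutelyContinuous_of_le (Measure.le_add_left le_rfl))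
  have hEeq : energyB (ρ, m) = ∫⁻ z, Psi (r z) (q z) ∂Λ := rfl
  rw [hEeq] at hE ⊢
  have hPm : Measurable fun z => Psi (r z) (q z) := measurable_Psi.comp (hrm.prodMk hqm)
  have hfin : ∀ᵐ z ∂Λ, Psi (r z) (q z) ≠ ⊤ :=
    (ae_lt_top hPm hE).mono fun z hz => hz.ne
  have hr0 : 0 ≤ᵐ[Λ] r := hfin.mono fun z hz => nonneg_of_Psi_ne_top hz
  set P : Measure (Cyl Ω) := Λ.withDensity fun z => ENNReal.ofReal (r z) with hP
  have hPfin : IsFiniteMeasure P := isFiniteMeasure_withDensity_ofReal hri.2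
  have hPint : ∀ g : Cyl Ω → ℝ, ∫ z, g z ∂P = ∫ z, g z * r z ∂Λ := by
    intro g
    rw [hP, integral_withDensity_eq_integral_toReal_smul (by fun_prop)
      (Eventually.of_forall fun _ => ENNReal.ofReal_lt_top)]
    refine integral_congr_ae ?_
    filter_upwards [hr0] with z hz
    rw [ENNReal.toReal_ofReal hz, smul_eq_mul, mul_comm]
  have hemb : Continuous fun z : Cyl Ω => ((z.1 : ℝ), (z.2 : Space d)) := by fun_prop
  refine ⟨P, hPfin, ?_, fun ψ hψ => ?_⟩
  · rw [← hρ]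
    ext s hs
    rw [Measure.toSignedMeasure_apply_measurable hs, withDensityᵥ_apply hri hs, measureReal_def,
      hP, withDensity_apply _ hs, integral_eq_lintegral_of_nonneg_ae
      (ae_restrict_of_ae hr0) hrm.aestronglyMeasurable]
  · obtain ⟨C₁, hC₁⟩ := hψ.exists_bound_timeDeriv
    obtain ⟨C₂, hC₂⟩ := hψ.exists_bound_spaceGrad
    have hmt : Measurable fun z : Cyl Ω => timeDeriv ψ (z.1, z.2) :=
      (hψ.continuous_timeDeriv.comp hemb).measurable
    have hmg : Continuous fun z : Cyl Ω => spaceGrad ψ (z.1, z.2) :=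
      hψ.continuous_spaceGrad.comp hemb
    have h := continuityEq_iff.1 hμ ψ hψ
    simp only at h
    rw [← hρ, ← hm, sint_withDensityᵥ hri hmt (fun z => hC₁ _),
      integral_withDensityᵥ _ hqi hmg.measurable.stronglyMeasurable (fun z => hC₂ _)] at h
    have i1 : Integrable (fun z => -innerSL ℝ (spaceGrad ψ (z.1, z.2)) (q z)) Λ := by
      refine Integrable.neg (Integrable.mono' (hqi.norm.const_mul C₂) ?_
        (Eventually.of_forall fun z => ?_))
      · exact (innerSL ℝ (E := Space d)).aestronglyMeasurable_comp₂ hmg.aestronglyMeasurable hqi.1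
      · refine (abs_real_inner_le_norm (spaceGrad ψ (z.1, z.2)) (q z)).trans ?_
        gcongr
        exact hC₂ _
    have i2 : Integrable (fun z => (Psi (r z) (q z)).toReal) Λ :=
      integrable_toReal_of_lintegral_ne_top hPm.aemeasurable hE
    have i3 : Integrable (fun z : Cyl Ω => 1 / 2 * (‖spaceGrad ψ (z.1, z.2)‖ ^ 2 * r z)) Λ := by
      refine (Integrable.bdd_mul (c := C₂ ^ 2) hri (hmg.norm.pow 2).aestronglyMeasurable
        (Eventually.of_forall fun z => ?_)).const_mul _
      simp only [Pi.pow_apply, norm_pow, norm_norm]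
      gcongr
      exact hC₂ _
    -- The continuity equation trades `∫ ∂_tψ dρ` for `-∫ ∇ψ · dm`, to which Young's inequality
    -- applies pointwise in the densities.
    rw [hPint, hPint, eq_neg_of_add_eq_zero_left h, ← integral_neg,
      ← integral_toReal hPm.aemeasurable (hfin.mono fun z hz => hz.lt_top),
      ← integral_const_mul, ← integral_add i2 i3]
    refine integral_mono_ae i1 (i2.add i3) ?_
    filter_upwards [hfin] with z hz
    exact neg_inner_le_of_Psi_ne_top hz _

end Energy

/-! ### Continuous functions on `[0,1]` tested against smooth functions -/

section Interval

theorem eq_zero_of_setIntegral_sq_nonpos {G : ℝ → ℝ} (hG : ContinuousOn G (Icc 0 1))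
    (h : ∫ t in Ioo (0 : ℝ) 1, G t ^ 2 ≤ 0) {t : ℝ} (ht : t ∈ Icc (0 : ℝ) 1) : G t = 0 := by
  have hint : IntegrableOn (fun t => G t ^ 2) (Ioo (0 : ℝ) 1) :=
    ((hG.pow 2).integrableOn_Icc).mono_set Ioo_subset_Icc_self
  have h0 : ∫ t in Ioo (0 : ℝ) 1, G t ^ 2 = 0 :=
    le_antisymm h (integral_nonneg fun t => sq_nonneg _)
  rw [integral_eq_zero_iff_of_nonneg (fun t => sq_nonneg _) hint] at h0
  have h1 : G =ᵐ[volume.restrict (Icc (0 : ℝ) 1)] 0 := by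
    rw [← restrict_Ioo_eq_restrict_Icc]
    filter_upwards [h0] with t ht
    simpa using ht
  exact Measure.eqOn_Icc_of_ae_eq volume zero_ne_one h1 hG continuousOn_const ht

/-- The derivative of the smoothed step is a probability density carried by `[a, a + ε]`, so the
integral is an average of `F` over that interval. -/
theorem abs_integral_deriv_smoothTransition_mul_sub_le {F : ℝ → ℝ} (hF : ContinuousOn F (Icc 0 1))
    {a ε δ : ℝ} (ha : 0 < a) (hε : 0 < ε) (haε : a + ε < 1)
    (hδ : ∀ x ∈ Icc a (a + ε), |F x - F a| ≤ δ) :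
    |(∫ t in Ioo (0 : ℝ) 1, deriv (fun x => Real.smoothTransition ((x - a) / ε)) t * F t) - F a|
      ≤ δ := by
  set S : ℝ → ℝ := fun x => Real.smoothTransition ((x - a) / ε) with hS
  have hSs : ContDiff ℝ ∞ S := Real.smoothTransition.contDiff.comp (by fun_prop)
  have hSd : Differentiable ℝ S := hSs.differentiable (by simp)
  have hc : Continuous (deriv S) := hSs.continuous_deriv (by simp)
  have hmono : Monotone S := fun x y hxy =>
    Real.smoothTransition.monotone (by gcongr)
  have hsub : Icc a (a + ε) ⊆ Ioo 0 1 := fun x hx => ⟨ha.trans_le hx.1, hx.2.trans_lt haε⟩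
  have hle : a ≤ a + ε := by linarith
  have hzero : ∀ x ∈ Ioo (0 : ℝ) 1 \ Icc a (a + ε), deriv S x * F x = 0 := by
    intro x hx
    have : deriv S x = 0 := by
      rcases lt_or_ge x a with h | h
      · have : S =ᶠ[𝓝 x] fun _ => 0 := by
          filter_upwards [Iio_mem_nhds h] with y hy
          exact Real.smoothTransition.zero_of_nonpos
            (div_nonpos_of_nonpos_of_nonneg (by linarith [mem_Iio.1 hy]) hε.le)
        rw [this.deriv_eq]; simp
      · have h' : a + ε < x := not_le.1 fun h' => hx.2 ⟨h, h'⟩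
        have : S =ᶠ[𝓝 x] fun _ => 1 := by
          filter_upwards [Ioi_mem_nhds h'] with y hy
          exact Real.smoothTransition.one_of_one_le
            ((one_le_div hε).2 (by linarith [mem_Ioi.1 hy]))
        rw [this.deriv_eq]; simp
    rw [this, zero_mul]
  have hFI : ContinuousOn F (Icc a (a + ε)) := hF.mono (hsub.trans Ioo_subset_Icc_self)
  rw [setIntegral_eq_of_subset_of_forall_sdiff_eq_zero measurableSet_Ioo hsub hzero,
    integral_Icc_eq_integral_Ioc, ← intervalIntegral.integral_of_le hle]
  have hone : ∫ t in a..(a + ε), deriv S t = 1 := by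
    rw [intervalIntegral.integral_deriv_eq_sub (fun x _ => hSd x) (hc.intervalIntegrable _ _)]
    simp [hS, hε.ne']
  have hi1 : IntervalIntegrable (fun t => deriv S t * F t) volume a (a + ε) := by
    refine ContinuousOn.intervalIntegrable ?_
    rw [uIcc_of_le hle]
    exact hc.continuousOn.mul hFI
  have hi2 : IntervalIntegrable (fun t => deriv S t * F a) volume a (a + ε) :=
    (hc.mul continuous_const).intervalIntegrable _ _
  have h1 : (∫ t in a..(a + ε), deriv S t * F t) - F a
      = ∫ t in a..(a + ε), deriv S t * (F t - F a) := by
    have : F a = ∫ t in a..(a + ε), deriv S t * F a := by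
      rw [intervalIntegral.integral_mul_const, hone, one_mul]
    nth_rw 1 [this]
    rw [← intervalIntegral.integral_sub hi1 hi2]
    simp_rw [mul_sub]
  rw [h1]
  have hd : δ = ∫ t in a..(a + ε), deriv S t * δ := by
    rw [intervalIntegral.integral_mul_const, hone, one_mul]
  rw [hd, ← Real.norm_eq_abs]
  refine intervalIntegral.norm_integral_le_of_norm_le hle (Eventually.of_forall fun t ht => ?_)
    ((hc.mul continuous_const).intervalIntegrable _ _)
  rw [norm_mul, Real.norm_of_nonneg (hmono.deriv_nonneg)]
  exact mul_le_mul_of_nonneg_left (hδ t (Ioc_subset_Icc_self ht)) hmono.deriv_nonneg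

/-- The hypothesis says weakly that `∫ F'² ≤ A`, and the conclusion is the resulting Hölder bound.
It is obtained by testing with a smoothed indicator of `[a, b]`, a difference of two smooth steps,
for which `∫ η'F` is close to `F a - F b`. Endpoints `0` and `1` are reached by continuity. -/
theorem sq_sub_le_of_forall_test {F : ℝ → ℝ} (hF : ContinuousOn F (Icc 0 1)) {A : ℝ} (hA : 0 ≤ A)
    (h : ∀ η : ℝ → ℝ, ContDiff ℝ ∞ η → HasCompactSupport η → tsupport η ⊆ Ioo 0 1 →
      (∫ t in Ioo (0 : ℝ) 1, deriv η t * F t) ^ 2 ≤ A * ∫ t in Ioo (0 : ℝ) 1, η t ^ 2)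
    {s t : ℝ} (hs : s ∈ Icc (0 : ℝ) 1) (ht : t ∈ Icc (0 : ℝ) 1) :
    (F t - F s) ^ 2 ≤ A * |t - s| := by
  have key : ∀ a b : ℝ, 0 < a → a < b → b < 1 → |F a - F b| ≤ √(A * (b - a)) := by
    intro a b ha hab hb
    have hcont : ∀ x ∈ Ioo (0 : ℝ) 1, ContinuousAt F x := fun x hx =>
      hF.continuousAt (Icc_mem_nhds hx.1 hx.2)
    have main : ∀ δ > 0, |F a - F b| ≤ √(A * (b - a + δ)) + 2 * δ := by
      intro δ hδ
      obtain ⟨ε₁, hε₁, h₁⟩ := Metric.continuousAt_iff.1 (hcont a ⟨ha, hab.trans hb⟩) δ hδ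
      obtain ⟨ε₂, hε₂, h₂⟩ := Metric.continuousAt_iff.1 (hcont b ⟨ha.trans hab, hb⟩) δ hδ
      -- The bounds `ε₁`, `ε₂` control the oscillation of `F`, `ε < δ` gives `∫ η² ≤ b - a + δ`, and
      -- `ε < 1 - b` keeps the support inside `(0,1)`.
      obtain ⟨ε, hε, hlt⟩ : ∃ ε > 0, ε < min (min ε₁ ε₂) (min δ (1 - b)) :=
        exists_between (lt_min (lt_min hε₁ hε₂) (lt_min hδ (by linarith)))
      simp only [lt_min_iff] at hlt
      obtain ⟨⟨hl1, hl2⟩, hl3, hl4⟩ := hlt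
      have e1 := abs_integral_deriv_smoothTransition_mul_sub_le hF (a := a) (δ := δ) ha hε
        (by linarith) fun x hx => (h₁ (by rw [Real.dist_eq, abs_lt]; constructor <;>
          linarith [hx.1, hx.2])).le
      have e2 := abs_integral_deriv_smoothTransition_mul_sub_le hF (a := b) (δ := δ)
        (ha.trans hab) hε
        (by linarith) fun x hx => (h₂ (by rw [Real.dist_eq, abs_lt]; constructor <;>
          linarith [hx.1, hx.2])).le
      set Sa : ℝ → ℝ := fun x => Real.smoothTransition ((x - a) / ε) with hSa
      set Sb : ℝ → ℝ := fun x => Real.smoothTransition ((x - b) / ε) with hSb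
      have hSas : ContDiff ℝ ∞ Sa := Real.smoothTransition.contDiff.comp (by fun_prop)
      have hSbs : ContDiff ℝ ∞ Sb := Real.smoothTransition.contDiff.comp (by fun_prop)
      have hvan : ∀ x, x ∉ Icc a (b + ε) → Sa x - Sb x = 0 := by
        intro x hx
        rcases lt_or_ge x a with hxa | hxa
        · simp only [hSa, hSb]
          rw [Real.smoothTransition.zero_of_nonpos, Real.smoothTransition.zero_of_nonpos, sub_zero]
          · exact div_nonpos_of_nonpos_of_nonneg (by linarith) hε.le
          · exact div_nonpos_of_nonpos_of_nonneg (by linarith) hε.le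
        · have hxb : b + ε < x := not_le.1 fun h' => hx ⟨hxa, h'⟩
          simp only [hSa, hSb]
          rw [Real.smoothTransition.one_of_one_le, Real.smoothTransition.one_of_one_le, sub_self]
          · exact (one_le_div hε).2 (by linarith)
          · exact (one_le_div hε).2 (by linarith)
      have hts : tsupport (Sa - Sb) ⊆ Icc a (b + ε) :=
        closure_minimal (fun x hx => by_contra fun hx' => hx (hvan x hx')) isClosed_Icc
      have hsub : Icc a (b + ε) ⊆ Ioo 0 1 := fun x hx =>
        ⟨ha.trans_le hx.1, hx.2.trans_lt (by linarith)⟩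
      have hη := h (Sa - Sb) (hSas.sub hSbs)
        (isCompact_Icc.of_isClosed_subset (isClosed_tsupport _) hts) (hts.trans hsub)
      have hsq : ∫ t in Ioo (0 : ℝ) 1, (Sa - Sb) t ^ 2 ≤ b - a + δ := by
        have hz : ∀ x ∈ Ioo (0 : ℝ) 1 \ Icc a (b + ε), (Sa - Sb) x ^ 2 = 0 := fun x hx => by
          rw [Pi.sub_apply, hvan x hx.2]; simp
        rw [setIntegral_eq_of_subset_of_forall_sdiff_eq_zero measurableSet_Ioo hsub hz]
        have hb1 : ∀ x ∈ Icc a (b + ε), ‖(Sa - Sb) x ^ 2‖ ≤ 1 := by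
          intro x _
          have := Real.smoothTransition.nonneg ((x - a) / ε)
          have := Real.smoothTransition.le_one ((x - a) / ε)
          have := Real.smoothTransition.nonneg ((x - b) / ε)
          have := Real.smoothTransition.le_one ((x - b) / ε)
          rw [norm_pow, Pi.sub_apply, Real.norm_eq_abs]
          refine pow_le_one₀ (abs_nonneg _) (abs_le.2 ⟨?_, ?_⟩) <;> simp only [hSa, hSb] <;> linarith
        have := norm_setIntegral_le_of_norm_le_const (μ := volume) (by simp) hb1
        refine (le_abs_self _).trans (this.trans ?_)
        rw [Real.volume_real_Icc_of_le (by linarith)]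
        linarith
      have hint : ∀ S : ℝ → ℝ, ContDiff ℝ ∞ S →
          IntegrableOn (fun t => deriv S t * F t) (Ioo (0 : ℝ) 1) := fun S hS =>
        (((hS.continuous_deriv (by simp)).continuousOn.mul hF).integrableOn_Icc).mono_set
          Ioo_subset_Icc_self
      have hsplit : ∫ t in Ioo (0 : ℝ) 1, deriv (Sa - Sb) t * F t
          = (∫ t in Ioo (0 : ℝ) 1, deriv Sa t * F t) - ∫ t in Ioo (0 : ℝ) 1, deriv Sb t * F t := by
        rw [← integral_sub (hint Sa hSas) (hint Sb hSbs)]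
        refine integral_congr_ae (Eventually.of_forall fun t => ?_)
        simp only
        rw [deriv_sub (hSas.differentiable (by simp) t) (hSbs.differentiable (by simp) t), sub_mul]
      rw [hsplit] at hη
      have hη' := Real.abs_le_sqrt (hη.trans (mul_le_mul_of_nonneg_left hsq hA))
      rw [abs_le] at *
      constructor <;> linarith [e1.1, e1.2, e2.1, e2.2, hη'.1, hη'.2]
    have hlim : Tendsto (fun δ => √(A * (b - a + δ)) + 2 * δ) (𝓝[>] 0)
        (𝓝 (√(A * (b - a + 0)) + 2 * 0)) := by
      refine Tendsto.mono_left (Continuous.tendsto (by fun_prop) 0) nhdsWithin_le_nhds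
    have := ge_of_tendsto hlim (eventually_mem_nhdsWithin.mono fun δ hδ => main δ hδ)
    simpa using this
  have key' : ∀ z ∈ Ioo (0 : ℝ) 1 ×ˢ Ioo (0 : ℝ) 1, (F z.2 - F z.1) ^ 2 ≤ A * |z.2 - z.1| := by
    rintro ⟨a, b⟩ ⟨ha, hb⟩
    rcases lt_trichotomy a b with hab | hab | hab
    · have := key a b ha.1 hab hb.2
      rw [abs_sub_comm, ← abs_of_pos (sub_pos.2 hab)] at this
      rw [← sq_abs]
      exact (Real.le_sqrt (abs_nonneg _) (by positivity)).1 this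
    · simp [hab]
    · have := key b a hb.1 hab ha.2
      rw [← abs_of_pos (sub_pos.2 hab), abs_sub_comm a b] at this
      rw [← sq_abs]
      exact (Real.le_sqrt (abs_nonneg _) (by positivity)).1 this
  have hcl : closure (Ioo (0 : ℝ) 1 ×ˢ Ioo (0 : ℝ) 1) = Icc 0 1 ×ˢ Icc 0 1 := by
    rw [closure_prod_eq, closure_Ioo zero_ne_one]
  have h1 : ContinuousOn (fun z : ℝ × ℝ => F z.1) (Icc 0 1 ×ˢ Icc 0 1) :=
    hF.comp continuousOn_fst fun z hz => hz.1
  have h2 : ContinuousOn (fun z : ℝ × ℝ => F z.2) (Icc 0 1 ×ˢ Icc 0 1) :=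
    hF.comp continuousOn_snd fun z hz => hz.2
  exact le_on_closure (x := (s, t)) key' (by rw [hcl]; exact (h2.sub h1).pow 2)
    (by rw [hcl]; fun_prop) (by rw [hcl]; exact ⟨hs, ht⟩)

end Interval

/-! ### Admissible curves -/

section Curves

variable {d : ℕ} {Ω : Set (Space d)}

theorem timeDeriv_smul (a : ℝ) (ψ : ℝ × Space d → ℝ) (z : ℝ × Space d) :
    timeDeriv (a • ψ) z = a * timeDeriv ψ z :=
  deriv_const_mul_field a

theorem spaceGrad_smul {ψ : ℝ × Space d → ℝ} (hψ : Differentiable ℝ ψ) (a : ℝ)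
    (z : ℝ × Space d) : spaceGrad (a • ψ) z = a • spaceGrad ψ z := by
  rw [spaceGrad_eq (hψ.const_smul a), spaceGrad_eq hψ, fderiv_const_smul (hψ z)]
  simp [ContinuousLinearMap.smul_comp]

/-- A quadratic polynomial in `l` that is nonnegative everywhere has nonpositive discriminant.
Applied to the multiples `lψ` of a test function, this turns the energy inequality into a
homogeneous one. -/
theorem sq_le_of_forall_mul_le {a b B : ℝ} (h : ∀ l : ℝ, l * a ≤ B + 1 / 2 * (l ^ 2 * b)) :
    a ^ 2 ≤ 2 * B * b := by
  have := discrim_le_zero (a := b / 2) (b := -a) (c := B) fun l => by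
    have := h l
    nlinarith
  rw [discrim] at this
  linarith

theorem sint_const_mul {Y : Type*} [MeasurableSpace Y] (σ : SignedMeasure Y) (a : ℝ) (g : Y → ℝ) :
    sint σ (fun y => a * g y) = a * sint σ g :=
  VectorMeasure.integral_smul g σ _ a

theorem Disintegrates.sint_eq {ρ : SignedMeasure (Cyl Ω)} {c : ℝ → SignedMeasure (closure Ω)}
    (h : Disintegrates ρ c) {g : ℝ → closure Ω → ℝ}
    (hg : Measurable fun z : Cyl Ω => g z.1 z.2) {C : ℝ} (hC : ∀ z : Cyl Ω, |g z.1 z.2| ≤ C) :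
    sint ρ (fun z => g z.1 z.2) = ∫ t in Ioo (0 : ℝ) 1, sint (c t) (g t) := by
  have := isFiniteMeasure_variation ρ
  rw [h.2 _ (Integrable.of_bound hg.aestronglyMeasurable C (Eventually.of_forall hC))]
  exact integral_subtype_comap measurableSet_Ioo fun t => sint (c t) (g t)

/-- A narrowly continuous curve of nonnegative measures of mass `M` that satisfies the dual form of
the bound `B` for the Benamou–Brenier energy. -/
structure Admissible (c : ℝ → SignedMeasure (closure Ω)) (M B : ℝ) : Prop where
  narrow : NarrowlyContinuous c
  nonneg : ∀ t ∈ Icc (0 : ℝ) 1, ∀ g : C(closure Ω, ℝ), 0 ≤ g → 0 ≤ sint (c t) g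
  mass : ∀ t ∈ Icc (0 : ℝ) 1, sint (c t) (1 : C(closure Ω, ℝ)) = M
  energy : ∀ ψ : ℝ × Space d → ℝ, IsTest ψ →
    ∫ t in Ioo (0 : ℝ) 1, sint (c t) (fun x => timeDeriv ψ (t, x))
      ≤ B + 1 / 2 * ∫ t in Ioo (0 : ℝ) 1, sint (c t) (fun x => ‖spaceGrad ψ (t, x)‖ ^ 2)

/-- A smooth function of compact support that is `1` near a given compact set. -/
theorem exists_cutoff (hΩ : Bornology.IsBounded Ω) : ∃ χ : Space d → ℝ, ContDiff ℝ ∞ χ ∧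
    HasCompactSupport χ ∧ ∀ x ∈ closure Ω, χ =ᶠ[𝓝 x] 1 := by
  obtain ⟨R, hR⟩ := hΩ.closure.subset_ball (0 : Space d)
  let b : ContDiffBump (0 : Space d) :=
    { rIn := max R 1, rOut := max R 1 + 1, rIn_pos := by positivity, rIn_lt_rOut := by linarith }
  refine ⟨b, b.contDiff, b.hasCompactSupport, fun x hx => b.eventuallyEq_one_of_mem_ball ?_⟩
  exact Metric.ball_subset_ball (le_max_left _ _) (hR hx)

variable [CompactSpace (closure Ω)] {c c' : ℝ → SignedMeasure (closure Ω)}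
  {ρ : SignedMeasure (Cyl Ω)}

theorem Disintegrates.sint_mul_eq (h : Disintegrates ρ c) {a : ℝ → ℝ}
    (ha : ContinuousOn a (Icc 0 1)) (g : C(closure Ω, ℝ)) :
    sint ρ (fun z => a z.1 * g z.2) = ∫ t in Ioo (0 : ℝ) 1, a t * sint (c t) g := by
  obtain ⟨K, hK⟩ := isCompact_Icc.exists_bound_of_continuousOn ha
  have ham : Continuous fun t : Ioo (0 : ℝ) 1 => a t :=
    ha.comp_continuous continuous_subtype_val fun t => Ioo_subset_Icc_self t.2
  have hm : Continuous fun z : Cyl Ω => a z.1 * g z.2 :=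
    (ham.comp continuous_fst).mul (g.continuous.comp continuous_snd)
  rw [h.sint_eq (g := fun t x => a t * g x) hm.measurable (C := K * ‖g‖) fun z => ?_]
  · simp_rw [sint_const_mul]
  · rw [abs_mul]
    exact mul_le_mul (hK _ (Ioo_subset_Icc_self z.1.2)) (g.norm_coe_le_norm _) (abs_nonneg _)
      ((norm_nonneg _).trans (hK _ (Ioo_subset_Icc_self z.1.2)))

/-- Testing `ρ` against `a(t)g(x)`, with `a` the difference of the two pairings itself, gives `∫ a²
= 0`. -/
theorem Disintegrates.sint_unique (h : Disintegrates ρ c) (hc : NarrowlyContinuous c)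
    (h' : Disintegrates ρ c') (hc' : NarrowlyContinuous c') {t : ℝ} (ht : t ∈ Icc (0 : ℝ) 1)
    (g : C(closure Ω, ℝ)) : sint (c t) g = sint (c' t) g := by
  have hF : ContinuousOn (fun t => sint (c t) g - sint (c' t) g) (Icc 0 1) := (hc g).sub (hc' g)
  have hint : ∀ {e : ℝ → SignedMeasure (closure Ω)}, NarrowlyContinuous e →
      IntegrableOn (fun t => (sint (c t) g - sint (c' t) g) * sint (e t) g) (Ioo 0 1) := fun he =>
    (hF.mul (he g)).integrableOn_Icc.mono_set Ioo_subset_Icc_self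
  have h1 := (h.sint_mul_eq hF g).symm.trans (h'.sint_mul_eq hF g)
  refine sub_eq_zero.1 (eq_zero_of_setIntegral_sq_nonpos hF (le_of_eq ?_) ht)
  rw [← sub_eq_zero, ← integral_sub (hint hc) (hint hc')] at h1
  refine Eq.trans ?_ h1
  congr 1 with t
  ring

/-- With `a` the negative part of `t ↦ ∫ g dc_t`, the integral of the nonnegative function
`a(t)g(x)` equals `-∫ a²`, so `a` vanishes. -/
theorem Disintegrates.nonneg {P : Measure (Cyl Ω)} [IsFiniteMeasure P]
    (h : Disintegrates P.toSignedMeasure c) (hc : NarrowlyContinuous c) {t : ℝ}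
    (ht : t ∈ Icc (0 : ℝ) 1) {g : C(closure Ω, ℝ)} (hg : 0 ≤ g) : 0 ≤ sint (c t) g := by
  have hF : ContinuousOn (fun t => max (-sint (c t) g) 0) (Icc 0 1) :=
    (hc g).neg.sup continuousOn_const
  have h1 := h.sint_mul_eq hF g
  rw [sint_toSignedMeasure] at h1
  have h2 : 0 ≤ ∫ z : Cyl Ω, max (-sint (c z.1) g) 0 * g z.2 ∂P :=
    integral_nonneg fun z => mul_nonneg (le_max_right _ _) (hg _)
  have h3 : max (-sint (c t) g) 0 = 0 := by
    refine eq_zero_of_setIntegral_sq_nonpos hF ?_ ht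
    rw [h1] at h2
    have h4 : ∀ t, max (-sint (c t) g) 0 ^ 2 = -(max (-sint (c t) g) 0 * sint (c t) g) := by
      intro t
      rcases le_total (sint (c t) g) 0 with hs | hs
      · rw [max_eq_left (by linarith)]; ring
      · rw [max_eq_right (by linarith)]; ring
    simp_rw [h4, integral_neg]
    linarith
  linarith [max_eq_right_iff.1 h3]

/-- The Hölder estimate for a curve of finite energy. -/
theorem sq_sint_sub_le (hc : NarrowlyContinuous c) {M B : ℝ} (hB : 0 ≤ B)
    (hpos : ∀ t ∈ Icc (0 : ℝ) 1, ∀ g : C(closure Ω, ℝ), 0 ≤ g → 0 ≤ sint (c t) g)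
    (hM : ∀ t ∈ Icc (0 : ℝ) 1, sint (c t) (1 : C(closure Ω, ℝ)) ≤ M) (hM0 : 0 ≤ M)
    (hE : ∀ ψ : ℝ × Space d → ℝ, IsTest ψ →
      ∫ t in Ioo (0 : ℝ) 1, sint (c t) (fun x => timeDeriv ψ (t, x))
        ≤ B + 1 / 2 * ∫ t in Ioo (0 : ℝ) 1, sint (c t) (fun x => ‖spaceGrad ψ (t, x)‖ ^ 2))
    {G : Space d → ℝ} (hG : ContDiff ℝ ∞ G) (hGc : HasCompactSupport G) {L : ℝ}
    (hL : ∀ x ∈ closure Ω, ‖gradient G x‖ ≤ L) {s t : ℝ} (hs : s ∈ Icc (0 : ℝ) 1)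
    (ht : t ∈ Icc (0 : ℝ) 1) :
    (sint (c t) (fun x => G x) - sint (c s) (fun x => G x)) ^ 2
      ≤ 2 * B * (L ^ 2 * M) * |t - s| := by
  have hGd : Differentiable ℝ G := hG.differentiable (by simp)
  let g : C(closure Ω, ℝ) := ⟨fun x => G x, hG.continuous.comp continuous_subtype_val⟩
  have hgrad : Continuous (gradient G) :=
    (LinearIsometryEquiv.continuous _).comp (hG.continuous_fderiv (by simp))
  let n : C(closure Ω, ℝ) :=
    ⟨fun x => ‖gradient G x‖ ^ 2, ((hgrad.norm).pow 2).comp continuous_subtype_val⟩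
  have hn : ∀ t ∈ Icc (0 : ℝ) 1, sint (c t) n ≤ L ^ 2 * M := fun t ht => by
    refine (le_abs_self _).trans ((abs_sint_le_of_nonneg (hpos t ht) n (C := L ^ 2) ?_).trans ?_)
    · intro x
      change |‖gradient G x‖ ^ 2| ≤ L ^ 2
      rw [abs_of_nonneg (by positivity)]
      gcongr
      exact hL x x.2
    · gcongr
      exact hM t ht
  refine sq_sub_le_of_forall_test (hc g) (by positivity) ?_ hs ht
  intro η hη hηc hηs
  have hηd : Differentiable ℝ η := hη.differentiable (by simp)
  have hψ := IsTest.mul hη hηc hηs hG hGc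
  set ψ : ℝ × Space d → ℝ := fun z => η z.1 * G z.2 with hψdef
  have h1 : (∫ t in Ioo (0 : ℝ) 1, deriv η t * sint (c t) g) ^ 2
      ≤ 2 * B * ∫ t in Ioo (0 : ℝ) 1, η t ^ 2 * sint (c t) n := by
    -- The energy inequality is tested with `l η(t) G(x)` for every real `l`.
    refine sq_le_of_forall_mul_le fun l => ?_
    have h := hE (l • ψ) (hψ.smul l)
    simp_rw [timeDeriv_smul, spaceGrad_smul hψ.differentiable, hψdef, timeDeriv_mul hηd,
      spaceGrad_mul _ hGd, norm_smul, mul_pow, Real.norm_eq_abs, sq_abs, sint_const_mul,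
      integral_const_mul] at h
    exact h
  refine h1.trans ?_
  rw [mul_assoc (2 * B)]
  refine mul_le_mul_of_nonneg_left ?_ (by positivity)
  rw [← integral_const_mul]
  refine integral_mono_of_nonneg ?_ ?_ ?_
  · filter_upwards [ae_restrict_mem measurableSet_Ioo] with t ht
    exact mul_nonneg (sq_nonneg _) (hpos t (Ioo_subset_Icc_self ht) n fun x => sq_nonneg _)
  · exact ((continuous_const.mul (hη.continuous.pow 2)).integrableOn_Icc).mono_set
      Ioo_subset_Icc_self
  · filter_upwards [ae_restrict_mem measurableSet_Ioo] with t ht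
    rw [mul_comm (L ^ 2 * M)]
    exact mul_le_mul_of_nonneg_left (hn t (Ioo_subset_Icc_self ht)) (sq_nonneg _)

/-- Positivity and the energy inequality are inherited from `ρ`. The mass is constant in time, and
since the time interval has length one it equals the total mass of `ρ`. -/
theorem ContinuityEq.admissible {μ : Pairs Ω} (hΩ : Bornology.IsBounded Ω) (hμ : ContinuityEq μ)
    (hE : energyB μ ≠ ⊤) (hd : Disintegrates μ.1 c) (hc : NarrowlyContinuous c) :
    Admissible c (μ.1.variation univ).toReal (energyB μ).toReal := by
  obtain ⟨P, hP, hμP, hen⟩ := hμ.exists_measure hE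
  rw [hμP] at hd ⊢
  have hpos : ∀ t ∈ Icc (0 : ℝ) 1, ∀ g : C(closure Ω, ℝ), 0 ≤ g → 0 ≤ sint (c t) g :=
    fun t ht g hg => hd.nonneg hc ht hg
  have hemb : Continuous fun z : Cyl Ω => ((z.1 : ℝ), (z.2 : Space d)) := by fun_prop
  have hener : ∀ ψ : ℝ × Space d → ℝ, IsTest ψ →
      ∫ t in Ioo (0 : ℝ) 1, sint (c t) (fun x => timeDeriv ψ (t, x)) ≤ (energyB μ).toReal
        + 1 / 2 * ∫ t in Ioo (0 : ℝ) 1, sint (c t) (fun x => ‖spaceGrad ψ (t, x)‖ ^ 2) := by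
    intro ψ hψ
    obtain ⟨C₁, hC₁⟩ := hψ.exists_bound_timeDeriv
    obtain ⟨C₂, hC₂⟩ := hψ.exists_bound_spaceGrad
    have h := hen ψ hψ
    rw [← sint_toSignedMeasure, ← sint_toSignedMeasure,
      hd.sint_eq (g := fun t x => timeDeriv ψ (t, x))
        (hψ.continuous_timeDeriv.comp hemb).measurable (fun z => hC₁ _),
      hd.sint_eq (g := fun t x => ‖spaceGrad ψ (t, x)‖ ^ 2) (C := C₂ ^ 2)
        (((hψ.continuous_spaceGrad.comp hemb).norm.pow 2).measurable) (fun z => ?_)] at h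
    · exact h
    · rw [abs_of_nonneg (by positivity)]
      gcongr
      exact hC₂ _
  -- The Hölder estimate needs some bound on the masses before they are known to be constant.
  obtain ⟨K, hK⟩ := isCompact_Icc.exists_bound_of_continuousOn (hc 1)
  have hconst : ∀ t ∈ Icc (0 : ℝ) 1,
      sint (c t) (1 : C(closure Ω, ℝ)) = sint (c 0) (1 : C(closure Ω, ℝ)) := by
    intro t ht
    -- The cutoff restricts to `1` and has zero gradient on `closure Ω`, so the Hölder estimate
    -- holds with `L = 0`.
    obtain ⟨χ, hχ, hχc, hχ1⟩ := exists_cutoff hΩ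
    have h := sq_sint_sub_le hc ENNReal.toReal_nonneg hpos
      (fun t ht => (le_abs_self _).trans (hK t ht))
      ((norm_nonneg _).trans (hK 0 ⟨le_rfl, zero_le_one⟩)) hener hχ hχc (L := 0) (fun x hx => by
        rw [gradient, (hχ1 x hx).fderiv_eq]; simp) (s := 0) ⟨le_rfl, zero_le_one⟩ ht
    have h1 : (fun x : closure Ω => χ x) = (1 : C(closure Ω, ℝ)) :=
      funext fun x => (hχ1 x x.2).eq_of_nhds
    rw [h1] at h
    have h2 : (sint (c t) (1 : C(closure Ω, ℝ)) - sint (c 0) (1 : C(closure Ω, ℝ))) ^ 2 ≤ 0 := by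
      simpa using h
    exact sub_eq_zero.1 (pow_eq_zero_iff two_ne_zero |>.1 (le_antisymm h2 (sq_nonneg _)))
  refine ⟨hc, hpos, fun t ht => ?_, hener⟩
  have h := hd.sint_mul_eq (a := fun _ => 1) continuousOn_const 1
  rw [sint_toSignedMeasure, setIntegral_congr_fun measurableSet_Ioo (g := fun _ =>
    sint (c 0) (1 : C(closure Ω, ℝ))) fun t ht => by
      simpa using hconst t (Ioo_subset_Icc_self ht)] at h
  rw [hconst t ht, Measure.variation_toSignedMeasure]
  simpa [Measure.real] using h.symm

end Curves

/-! ### From admissible curves to pairs -/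

section Reconstruction

/-- The bound makes `ℓ` vanish on the kernel of `A`, so it descends to a functional of norm at most
`C` on the range. Hahn–Banach extends it and Riesz represents it. -/
theorem exists_inner_eq_of_abs_le {T H : Type*} [AddCommGroup T] [Module ℝ T]
    [NormedAddCommGroup H] [InnerProductSpace ℝ H] [CompleteSpace H] (A : T →ₗ[ℝ] H)
    (ℓ : T →ₗ[ℝ] ℝ) {C : ℝ} (hC : 0 ≤ C) (h : ∀ ψ, |ℓ ψ| ≤ C * ‖A ψ‖) :
    ∃ v : H, ‖v‖ ≤ C ∧ ∀ ψ, ⟪v, A ψ⟫ = ℓ ψ := by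
  obtain ⟨S, hS⟩ := A.rangeRestrict.exists_rightInverse_of_surjective A.range_rangeRestrict
  have hS' : ∀ y, A (S y) = y := fun y => congrArg Subtype.val (LinearMap.congr_fun hS y)
  let g : StrongDual ℝ (LinearMap.range A) := (ℓ ∘ₗ S).mkContinuous C fun y => by
    have := h (S y)
    rwa [hS'] at this
  have hg : ∀ ψ, g (A.rangeRestrict ψ) = ℓ ψ := by
    intro ψ
    have h1 := h (S (A.rangeRestrict ψ) - ψ)
    rw [map_sub, map_sub, hS'] at h1
    have h2 : ℓ (S (A.rangeRestrict ψ)) = ℓ ψ := by simpa [sub_eq_zero] using h1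
    exact h2
  obtain ⟨G, hG, hGn⟩ := exists_extension_norm_eq _ g
  refine ⟨(InnerProductSpace.toDual ℝ H).symm G, ?_, fun ψ => ?_⟩
  · rw [LinearIsometryEquiv.norm_map, hGn]
    exact LinearMap.mkContinuous_norm_le _ hC _
  · rw [InnerProductSpace.toDual_symm_apply, ← hg ψ, ← hG]
    rfl

/-- Indicators of closed sets are limits of continuous functions, and closed sets form a π-system
generating the Borel sets. -/
theorem measurable_of_continuousOn_integral {T Y : Type*} [MeasurableSpace T] [TopologicalSpace T]
    [OpensMeasurableSpace T] [TopologicalSpace Y] [CompactSpace Y]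
    [TopologicalSpace.PseudoMetrizableSpace Y] [MeasurableSpace Y] [BorelSpace Y]
    (ν : T → Measure Y) [∀ t, IsFiniteMeasure (ν t)]
    (h : ∀ g : C(Y, ℝ), Continuous fun t => ∫ y, g y ∂ν t) : Measurable ν := by
  have hlin : ∀ g : C(Y, NNReal), Measurable fun t => ∫⁻ y, g y ∂ν t := by
    intro g
    have h1 : ∀ t, ∫⁻ y, g y ∂ν t = ENNReal.ofReal (∫ y, (g y : ℝ) ∂ν t) := by
      intro t
      rw [ofReal_integral_eq_lintegral_ofReal]
      · simp
      · exact Integrable.of_bound (by fun_prop) ‖(⟨fun y => (g y : ℝ), by fun_prop⟩ : C(Y, ℝ))‖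
          (Eventually.of_forall (ContinuousMap.norm_coe_le_norm ⟨fun y => (g y : ℝ), by fun_prop⟩))
      · exact Eventually.of_forall fun y => (g y).2
    simp_rw [h1]
    exact (h ⟨fun y => (g y : ℝ), by fun_prop⟩).measurable.ennreal_ofReal
  refine Measurable.measure_of_isPiSystem (S := {s | IsClosed s})
    (by rw [← borel_eq_generateFrom_isClosed]; exact BorelSpace.measurable_eq)
    (fun s hs t ht _ => IsClosed.inter hs ht) (fun F hF => ?_) ?_
  · refine measurable_of_tendsto_metrizable (f := fun n t => ∫⁻ y, hF.apprSeq n y ∂ν t)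
      (fun n => hlin (hF.apprSeq n).toContinuousMap) ?_
    exact tendsto_pi_nhds.2 fun t => HasOuterApproxClosed.tendsto_lintegral_apprSeq hF (ν t)
  · simpa using hlin 1

variable {d : ℕ} {Ω : Set (Space d)}

/-- The test functions as a vector space. -/
def testFunctions (d : ℕ) : Submodule ℝ (ℝ × Space d → ℝ) where
  carrier := {ψ | IsTest ψ}
  zero_mem' := IsTest.zero
  add_mem' := fun {ψ χ} hψ hχ => by simpa using IsTest.linear hψ hχ 1
  smul_mem' := fun a _ hψ => IsTest.smul hψ a

theorem continuous_cyl_coe : Continuous fun z : Cyl Ω => ((z.1 : ℝ), (z.2 : Space d)) := by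
  fun_prop

theorem IsTest.memLp_spaceGrad {ψ : ℝ × Space d → ℝ} (hψ : IsTest ψ) (P : Measure (Cyl Ω))
    [IsFiniteMeasure P] : MemLp (fun z : Cyl Ω => spaceGrad ψ (z.1, z.2)) 2 P := by
  obtain ⟨C, hC⟩ := hψ.exists_bound_spaceGrad
  exact MemLp.of_bound (hψ.continuous_spaceGrad.comp continuous_cyl_coe).aestronglyMeasurable C
    (Eventually.of_forall fun z => hC _)

theorem IsTest.integrable_timeDeriv {ψ : ℝ × Space d → ℝ} (hψ : IsTest ψ) (P : Measure (Cyl Ω))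
    [IsFiniteMeasure P] : Integrable (fun z : Cyl Ω => timeDeriv ψ (z.1, z.2)) P := by
  obtain ⟨C, hC⟩ := hψ.exists_bound_timeDeriv
  exact Integrable.of_bound (hψ.continuous_timeDeriv.comp continuous_cyl_coe).aestronglyMeasurable C
    (Eventually.of_forall fun z => hC _)

/-- A measure satisfying the dual form of the energy bound carries an `L²` velocity field that
solves the continuity equation. -/
theorem exists_velocity (P : Measure (Cyl Ω)) [IsFiniteMeasure P] {B : ℝ} (hB : 0 ≤ B)
    (h : ∀ ψ : ℝ × Space d → ℝ, IsTest ψ → ∫ z : Cyl Ω, timeDeriv ψ (z.1, z.2) ∂P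
      ≤ B + 1 / 2 * ∫ z : Cyl Ω, ‖spaceGrad ψ (z.1, z.2)‖ ^ 2 ∂P) :
    ∃ v : Cyl Ω → Space d, StronglyMeasurable v ∧ MemLp v 2 P ∧ ∫ z, ‖v z‖ ^ 2 ∂P ≤ 2 * B ∧
      ContinuityEq (P.toSignedMeasure, P.withDensityᵥ v) := by
  let A : testFunctions d →ₗ[ℝ] Lp (Space d) 2 P :=
    { toFun := fun ψ => (IsTest.memLp_spaceGrad ψ.2 P).toLp
      map_add' := fun ψ χ => by
        rw [← MemLp.toLp_add]
        refine MemLp.toLp_congr _ _ (Eventually.of_forall fun z => ?_)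
        simpa using spaceGrad_linear (IsTest.differentiable ψ.2) (IsTest.differentiable χ.2) 1 _
      map_smul' := fun a ψ => by
        rw [RingHom.id_apply, ← MemLp.toLp_const_smul]
        refine MemLp.toLp_congr _ _ (Eventually.of_forall fun z => ?_)
        exact spaceGrad_smul (IsTest.differentiable ψ.2) a _ }
  -- With this sign, `⟪v, ∇ψ⟫ = ℓ ψ` in `L²(P)` is exactly the continuity equation for `m = vP`.
  let ℓ : testFunctions d →ₗ[ℝ] ℝ :=
    { toFun := fun ψ => -∫ z : Cyl Ω, timeDeriv (ψ : ℝ × Space d → ℝ) (z.1, z.2) ∂P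
      map_add' := fun ψ χ => by
        rw [← neg_add, ← integral_add (IsTest.integrable_timeDeriv ψ.2 P)
          (IsTest.integrable_timeDeriv χ.2 P)]
        congr 2 with z
        simpa using timeDeriv_linear (IsTest.differentiable ψ.2) (IsTest.differentiable χ.2) 1 _
      map_smul' := fun a ψ => by
        rw [RingHom.id_apply, smul_eq_mul, mul_neg, ← integral_const_mul]
        congr 2 with z
        exact timeDeriv_smul a _ _ }
  have hAn : ∀ ψ : testFunctions d,
      ‖A ψ‖ ^ 2 = ∫ z : Cyl Ω, ‖spaceGrad (ψ : ℝ × Space d → ℝ) (z.1, z.2)‖ ^ 2 ∂P := by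
    intro ψ
    rw [← real_inner_self_eq_norm_sq, L2.inner_def]
    refine integral_congr_ae ?_
    filter_upwards [(IsTest.memLp_spaceGrad ψ.2 P).coeFn_toLp] with z hz
    rw [real_inner_self_eq_norm_sq]
    exact congrArg (fun x => ‖x‖ ^ 2) hz
  have hbound : ∀ ψ, |ℓ ψ| ≤ √(2 * B) * ‖A ψ‖ := by
    intro ψ
    rw [← Real.sqrt_sq (norm_nonneg (A ψ)), ← Real.sqrt_mul (by positivity)]
    refine Real.abs_le_sqrt ?_
    change (-∫ z : Cyl Ω, timeDeriv (ψ : ℝ × Space d → ℝ) (z.1, z.2) ∂P) ^ 2 ≤ _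
    rw [neg_sq, hAn]
    refine sq_le_of_forall_mul_le fun l => ?_
    have := h (l • ψ) (IsTest.smul ψ.2 l)
    simp_rw [timeDeriv_smul, spaceGrad_smul (IsTest.differentiable ψ.2), norm_smul, mul_pow,
      Real.norm_eq_abs, sq_abs, integral_const_mul] at this
    exact this
  obtain ⟨v, hv, hvA⟩ := exists_inner_eq_of_abs_le A ℓ (Real.sqrt_nonneg _) hbound
  have hvi : Integrable v P := (Lp.memLp v).integrable (by norm_num)
  refine ⟨v, Lp.stronglyMeasurable v, Lp.memLp v, ?_, continuityEq_iff.2 fun ψ hψ => ?_⟩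
  · have h1 : ∫ z, ‖v z‖ ^ 2 ∂P = ‖v‖ ^ 2 := by
      rw [← real_inner_self_eq_norm_sq, L2.inner_def]
      simp_rw [real_inner_self_eq_norm_sq]
    rw [h1, ← Real.sq_sqrt (show 0 ≤ 2 * B by positivity)]
    gcongr
  · obtain ⟨C, hC⟩ := hψ.exists_bound_spaceGrad
    simp only
    rw [sint_toSignedMeasure, integral_withDensityᵥ (ξ := fun z : Cyl Ω =>
      spaceGrad ψ (z.1, z.2)) _ hvi
      (hψ.continuous_spaceGrad.comp continuous_cyl_coe).measurable.stronglyMeasurable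
      (fun z => hC _)]
    have h1 := hvA ⟨ψ, hψ⟩
    rw [L2.inner_def] at h1
    have h2 : ∫ z : Cyl Ω, innerSL ℝ (spaceGrad ψ (z.1, z.2)) (v z) ∂P
        = -∫ z : Cyl Ω, timeDeriv ψ (z.1, z.2) ∂P := by
      refine Eq.trans (integral_congr_ae ?_) h1
      filter_upwards [(IsTest.memLp_spaceGrad hψ P).coeFn_toLp] with z hz
      rw [innerSL_apply_apply, real_inner_comm]
      exact congrArg (inner ℝ (v z)) hz.symm
    rw [h2, add_neg_cancel]

theorem component_withDensityᵥ {Y : Type*} [MeasurableSpace Y] {P : Measure Y} {v : Y → Space d}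
    (hv : Integrable v P) (i : Fin d) :
    component (P.withDensityᵥ v) i = P.withDensityᵥ fun z => v z i := by
  ext s hs
  rw [component_apply, withDensityᵥ_apply hv hs, withDensityᵥ_apply (hv.eval_piLp i) hs]
  exact (ContinuousLinearMap.integral_comp_comm
    (EuclideanSpace.proj (𝕜 := ℝ) i : Space d →L[ℝ] ℝ) hv.integrableOn).symm

theorem rnDeriv_withDensityᵥ_ae_eq {Y : Type*} [MeasurableSpace Y] {P Λ : Measure Y}
    [IsFiniteMeasure P] [IsFiniteMeasure Λ] (hac : P ≪ Λ) {f : Y → ℝ} (hf : Integrable f P) :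
    SignedMeasure.rnDeriv (P.withDensityᵥ f) Λ =ᵐ[Λ] fun z => (P.rnDeriv Λ z).toReal * f z := by
  refine (SignedMeasure.eq_rnDeriv 0 _ ((integrable_rnDeriv_smul_iff hac).2 hf) ?_ ?_).symm
  · exact VectorMeasure.MutuallySingular.zero_left
  · rw [zero_add]
    exact (withDensityᵥ_rnDeriv_smul hac hf).symm

/-- With `p = dP/dΛ` the two densities are `p` and `pv`, and `Ψ(p, pv) = p|v|²/2`, also where `p =
0`. -/
theorem energyB_withDensityᵥ_le (P : Measure (Cyl Ω)) [IsFiniteMeasure P] {v : Cyl Ω → Space d}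
    (hvm : StronglyMeasurable v) (hv : MemLp v 2 P) :
    energyB (P.toSignedMeasure, P.withDensityᵥ v)
      ≤ ENNReal.ofReal (1 / 2 * ∫ z, ‖v z‖ ^ 2 ∂P) := by
  have hvi : Integrable v P := hv.integrable (by norm_num)
  have := isFiniteMeasure_variation P.toSignedMeasure
  have := isFiniteMeasure_variation_vector (P.withDensityᵥ v)
  rw [energyB]
  set Λ := P.toSignedMeasure.variation + (P.withDensityᵥ v).variation
  have hac : P ≪ Λ := by
    refine Measure.absolutelyContinuous_of_le ?_
    simp only [Λ, Measure.variation_toSignedMeasure]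
    exact Measure.le_add_right le_rfl
  have hone : P.withDensityᵥ (fun _ => (1 : ℝ)) = P.toSignedMeasure := by
    ext s hs
    rw [withDensityᵥ_apply (integrable_const _) hs, Measure.toSignedMeasure_apply_measurable hs]
    simp
  have h1 := rnDeriv_withDensityᵥ_ae_eq hac (integrable_const (μ := P) (1 : ℝ))
  rw [hone] at h1
  have h2 : ∀ i, (component (P.withDensityᵥ v) i).rnDeriv Λ
      =ᵐ[Λ] fun z => (P.rnDeriv Λ z).toReal * v z i := fun i => by
    rw [component_withDensityᵥ hvi]
    exact rnDeriv_withDensityᵥ_ae_eq hac (hvi.eval_piLp i)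
  have hsq : Integrable (fun z => ‖v z‖ ^ 2) P := hv.integrable_norm_pow (by norm_num)
  have h3 : ENNReal.ofReal (1 / 2 * ∫ z, ‖v z‖ ^ 2 ∂P)
      = ∫⁻ z, P.rnDeriv Λ z * ENNReal.ofReal (1 / 2 * ‖v z‖ ^ 2) ∂Λ := by
    rw [lintegral_rnDeriv_mul hac (by
      exact ((hvm.measurable.norm.pow_const 2).const_mul _).ennreal_ofReal.aemeasurable),
      ← integral_const_mul, ofReal_integral_eq_lintegral_ofReal (hsq.const_mul _)
        (Eventually.of_forall fun z => by positivity)]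
  rw [h3, energyWrt]
  refine lintegral_mono_ae ?_
  filter_upwards [h1, ae_all_iff.2 h2, P.rnDeriv_lt_top Λ] with z hz1 hz2 hz3
  have hvec : (WithLp.toLp 2 fun i => (component (P.withDensityᵥ v) i).rnDeriv Λ z : Space d)
      = (P.rnDeriv Λ z).toReal • v z := by
    ext i
    simp [hz2 i]
  rw [hz1, hvec, mul_one]
  rcases ENNReal.toReal_nonneg.eq_or_lt with h0 | h0
  · rw [← h0]
    simp [Psi]
  · rw [Psi, if_pos h0]
    nth_rw 3 [← ENNReal.ofReal_toReal hz3.ne]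
    rw [← ENNReal.ofReal_mul h0.le]
    refine ENNReal.ofReal_le_ofReal (le_of_eq ?_)
    rw [norm_smul, Real.norm_of_nonneg h0.le]
    field_simp

variable [CompactSpace (closure Ω)]

/-- Narrow continuity makes `t ↦ ν t` a kernel, so `dt ⊗ ν_t` is a measure. It inherits the dual
inequality from the curve, which supplies the velocity. -/
theorem Admissible.exists_pair {ν : ℝ → Measure (closure Ω)} [∀ t, IsFiniteMeasure (ν t)]
    {M B : ℝ} (h : Admissible (fun t => (ν t).toSignedMeasure) M B) (hB : 0 ≤ B) :
    ∃ μ : Pairs Ω, Disintegrates μ.1 (fun t => (ν t).toSignedMeasure) ∧ ContinuityEq μ ∧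
      energyB μ ≤ ENNReal.ofReal B ∧ μ.1.variation univ = ENNReal.ofReal M := by
  have hmeas : Measurable fun t : Icc (0 : ℝ) 1 => ν t := by
    refine measurable_of_continuousOn_integral _ fun g => ?_
    have h1 := (h.narrow g).domRestrict
    simp only [sint_toSignedMeasure] at h1
    exact h1
  have hMν : ∀ t ∈ Icc (0 : ℝ) 1, ν t univ = ENNReal.ofReal M := by
    intro t ht
    have h1 := h.mass t ht
    rw [sint_toSignedMeasure] at h1
    rw [← h1]
    simp [Measure.real]
  let τ : Measure (Ioo (0 : ℝ) 1) := volume.comap Subtype.val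
  have hτ : τ univ = 1 := by
    change (volume.comap Subtype.val) univ = 1
    rw [comap_subtype_coe_apply measurableSet_Ioo, image_univ, Subtype.range_coe]
    simp
  have hτf : IsFiniteMeasure τ := ⟨by rw [hτ]; exact ENNReal.one_lt_top⟩
  let κ : ProbabilityTheory.Kernel (Ioo (0 : ℝ) 1) (closure Ω) :=
    ⟨fun t => ν t, hmeas.comp (g := fun t : Icc (0 : ℝ) 1 => ν t)
      (f := fun t : Ioo (0 : ℝ) 1 => (⟨t, Ioo_subset_Icc_self t.2⟩ : Icc (0 : ℝ) 1))
      (by fun_prop)⟩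
  have hκ : ProbabilityTheory.IsFiniteKernel κ :=
    ⟨ENNReal.ofReal M, ENNReal.ofReal_lt_top, fun t => (hMν t (Ioo_subset_Icc_self t.2)).le⟩
  let P : Measure (Cyl Ω) := τ.compProd κ
  have hPi : ∀ φ : Cyl Ω → ℝ, Integrable φ P → ∫ z, φ z ∂P = ∫ t, ∫ x, φ (t, x) ∂ν t ∂τ :=
    fun φ hφ => Measure.integral_compProd hφ
  have hdis : Disintegrates P.toSignedMeasure (fun t => (ν t).toSignedMeasure) := by
    refine ⟨fun A hA => ?_, fun φ hφ => ?_⟩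
    · simp only [Measure.toSignedMeasure_apply_measurable hA]
      exact ((Measure.measurable_coe hA).comp hmeas).ennreal_toReal
    · rw [VectorMeasure.Integrable, Measure.variation_toSignedMeasure] at hφ
      simp only [sint_toSignedMeasure]
      exact hPi φ hφ
  have hen : ∀ ψ : ℝ × Space d → ℝ, IsTest ψ → ∫ z : Cyl Ω, timeDeriv ψ (z.1, z.2) ∂P
      ≤ B + 1 / 2 * ∫ z : Cyl Ω, ‖spaceGrad ψ (z.1, z.2)‖ ^ 2 ∂P := by
    intro ψ hψ
    obtain ⟨C₁, hC₁⟩ := hψ.exists_bound_timeDeriv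
    obtain ⟨C₂, hC₂⟩ := hψ.exists_bound_spaceGrad
    rw [← sint_toSignedMeasure, ← sint_toSignedMeasure,
      hdis.sint_eq (g := fun t x => timeDeriv ψ (t, x))
        (hψ.continuous_timeDeriv.comp continuous_cyl_coe).measurable (fun z => hC₁ _),
      hdis.sint_eq (g := fun t x => ‖spaceGrad ψ (t, x)‖ ^ 2) (C := C₂ ^ 2)
        (((hψ.continuous_spaceGrad.comp continuous_cyl_coe).norm.pow 2).measurable) (fun z => ?_)]
    · exact h.energy ψ hψ
    · rw [abs_of_nonneg (by positivity)]
      gcongr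
      exact hC₂ _
  obtain ⟨v, hvm, hv, hvB, hcont⟩ := exists_velocity P hB hen
  refine ⟨(P.toSignedMeasure, P.withDensityᵥ v), hdis, hcont, ?_, ?_⟩
  · refine (energyB_withDensityᵥ_le P hvm hv).trans (ENNReal.ofReal_le_ofReal ?_)
    linarith
  · simp only [Measure.variation_toSignedMeasure]
    rw [Measure.compProd_apply MeasurableSet.univ]
    have h1 : ∀ t, κ t (Prod.mk t ⁻¹' univ) = ENNReal.ofReal M := fun t =>
      hMν t (Ioo_subset_Icc_self t.2)
    simp_rw [h1, lintegral_const, hτ, mul_one]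

end Reconstruction

/-! ### Convergence of narrowly continuous curves -/

section Compactness

theorem aemeasurable_eval_nat {Φ : ℕ → ℝ → ℝ} {μ : Measure ℝ} (h : ∀ k, AEMeasurable (Φ k) μ)
    {N : ℝ → ℕ} (hN : Measurable N) : AEMeasurable (fun t => Φ (N t) t) μ := by
  have hm : Measurable fun p : ℕ × ℝ => (h p.1).mk (Φ p.1) p.2 :=
    measurable_from_prod_countable_right fun k => (h k).measurable_mk
  refine ⟨fun t => (h (N t)).mk (Φ (N t)) t, hm.comp (hN.prodMk measurable_id), ?_⟩
  filter_upwards [ae_all_iff.2 fun k => (h k).ae_eq_mk] with t ht using ht (N t)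

theorem exists_tendsto_of_approx {a : ℕ → ℝ}
    (h : ∀ ε > 0, ∃ b : ℕ → ℝ, (∃ l, Tendsto b atTop (𝓝 l)) ∧ ∀ n, |a n - b n| ≤ ε) :
    ∃ l, Tendsto a atTop (𝓝 l) := by
  refine cauchySeq_tendsto_of_complete (Metric.cauchySeq_iff'.2 fun ε hε => ?_)
  obtain ⟨b, ⟨l, hb⟩, hab⟩ := h (ε / 4) (by positivity)
  obtain ⟨N, hN⟩ := Metric.cauchySeq_iff'.1 hb.cauchySeq (ε / 4) (by positivity)
  refine ⟨N, fun n hn => ?_⟩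
  have h1 := hN n hn
  have h2 := hab n
  have h3 := hab N
  rw [Real.dist_eq] at *
  rw [abs_lt] at *
  rw [abs_le] at h2 h3
  constructor <;> linarith [h1.1, h1.2, h2.1, h2.2, h3.1, h3.2]

theorem exists_subseq_tendsto_of_abs_le {ι : Type*} [Countable ι] {f : ℕ → ι → ℝ} {C : ι → ℝ}
    (h : ∀ n i, |f n i| ≤ C i) : ∃ (k : ℕ → ℕ) (a : ι → ℝ), StrictMono k ∧
      ∀ i, Tendsto (fun n => f (k n) i) atTop (𝓝 (a i)) := by
  obtain ⟨a, -, k, hk, hlim⟩ := (isCompact_univ_pi fun i =>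
    isCompact_Icc (a := -C i) (b := C i)).tendsto_subseq (x := f) fun n i _ => abs_le.1 (h n i)
  exact ⟨k, a, hk, tendsto_pi_nhds.1 hlim⟩

variable {d : ℕ} {Ω : Set (Space d)}

/-- Freezing the curve at the grid times `⌊tn⌋/n` leaves countably many fixed measures, covered by
`hG`. Narrow continuity recovers the curve as `n → ∞`. -/
theorem NarrowlyContinuous.aemeasurable_sint {c : ℝ → SignedMeasure (closure Ω)}
    (hc : NarrowlyContinuous c) {G : ℝ → C(closure Ω, ℝ)}
    (hG : ∀ σ : SignedMeasure (closure Ω), AEMeasurable (fun t => sint σ (G t)) timeMeasure) :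
    AEMeasurable (fun t => sint (c t) (G t)) timeMeasure := by
  refine aemeasurable_of_tendsto_metrizable_ae atTop
    (f := fun (n : ℕ) (t : ℝ) => sint (c (⌊t * n⌋₊ / n)) (G t)) (fun n => ?_) ?_
  · exact aemeasurable_eval_nat (Φ := fun k t => sint (c (k / n)) (G t)) (fun k => hG _)
      (Nat.measurable_floor.comp (measurable_id.mul_const _))
  · filter_upwards [ae_restrict_mem measurableSet_Ioo] with t ht
    have h1 : Tendsto (fun n : ℕ => (⌊t * n⌋₊ : ℝ) / n) atTop (𝓝 t) :=
      (tendsto_nat_floor_mul_div_atTop ht.1.le).comp tendsto_natCast_atTop_atTop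
    have h2 : ∀ n : ℕ, (⌊t * n⌋₊ : ℝ) / n ∈ Icc (0 : ℝ) 1 := by
      refine fun n => ⟨by positivity, div_le_one_of_le₀ ?_ (by positivity)⟩
      refine (Nat.floor_le (by have := ht.1.le; positivity)).trans ?_
      exact mul_le_of_le_one_left (by positivity) ht.2.le
    exact (hc (G t) t (Ioo_subset_Icc_self ht)).tendsto.comp
      (tendsto_nhdsWithin_iff.2 ⟨h1, Eventually.of_forall h2⟩)

theorem Admissible.mass_nonneg {c : ℝ → SignedMeasure (closure Ω)} {M B : ℝ}
    (h : Admissible c M B) : 0 ≤ M := by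
  rw [← h.mass 0 ⟨le_rfl, zero_le_one⟩]
  exact h.nonneg 0 ⟨le_rfl, zero_le_one⟩ 1 fun _ => zero_le_one

variable [CompactSpace (closure Ω)]

/-- Positivity and the mass bound give the majorant `b(t)R` for dominated convergence. This serves
both the energy inequality, with `G` built from a test function, and the linear term, with `G = w`.
-/
theorem tendsto_integral_sint {c : ℕ → ℝ → SignedMeasure (closure Ω)}
    {c' : ℝ → SignedMeasure (closure Ω)} (hc : ∀ n, NarrowlyContinuous (c n))
    (hpos : ∀ n, ∀ t ∈ Icc (0 : ℝ) 1, ∀ g : C(closure Ω, ℝ), 0 ≤ g → 0 ≤ sint (c n t) g) {R : ℝ}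
    (hR : ∀ n, ∀ t ∈ Icc (0 : ℝ) 1, sint (c n t) (1 : C(closure Ω, ℝ)) ≤ R)
    (hlim : ∀ t ∈ Icc (0 : ℝ) 1, ∀ g : C(closure Ω, ℝ),
      Tendsto (fun n => sint (c n t) g) atTop (𝓝 (sint (c' t) g)))
    {G : ℝ → C(closure Ω, ℝ)}
    (hG : ∀ σ : SignedMeasure (closure Ω), AEMeasurable (fun t => sint σ (G t)) timeMeasure)
    {b : ℝ → ℝ} (hb : Integrable b timeMeasure) (hb0 : ∀ᵐ t ∂timeMeasure, 0 ≤ b t)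
    (hGb : ∀ᵐ t ∂timeMeasure, ∀ x, |G t x| ≤ b t) :
    Tendsto (fun n => ∫ t, sint (c n t) (G t) ∂timeMeasure) atTop
      (𝓝 (∫ t, sint (c' t) (G t) ∂timeMeasure)) := by
  refine tendsto_integral_of_dominated_convergence (fun t => b t * R)
    (fun n => ((hc n).aemeasurable_sint hG).aestronglyMeasurable) (hb.mul_const R) (fun n => ?_) ?_
  · filter_upwards [ae_restrict_mem measurableSet_Ioo, hb0, hGb] with t ht h0 h
    refine (abs_sint_le_of_nonneg (hpos n t (Ioo_subset_Icc_self ht)) (G t) h).trans ?_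
    exact mul_le_mul_of_nonneg_left (hR n t (Ioo_subset_Icc_self ht)) h0
  · filter_upwards [ae_restrict_mem measurableSet_Ioo] with t ht
    exact hlim t (Ioo_subset_Icc_self ht) _

/-- The continuous functions on `closure Ω` that extend to smooth functions of compact support. -/
def smoothRestrictions (hΩ : Bornology.IsBounded Ω) : Subalgebra ℝ C(closure Ω, ℝ) where
  carrier := {g | ∃ G : Space d → ℝ, ContDiff ℝ ∞ G ∧ HasCompactSupport G ∧ ∀ x, g x = G x}
  mul_mem' := by
    rintro g h ⟨G, hG, hGc, hgG⟩ ⟨H, hH, -, hhH⟩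
    exact ⟨G * H, hG.mul hH, hGc.mul_right, fun x => by simp [hgG, hhH]⟩
  add_mem' := by
    rintro g h ⟨G, hG, hGc, hgG⟩ ⟨H, hH, hHc, hhH⟩
    exact ⟨G + H, hG.add hH, hGc.add hHc, fun x => by simp [hgG, hhH]⟩
  algebraMap_mem' := fun r => by
    obtain ⟨χ, hχ, hχc, hχ1⟩ := exists_cutoff hΩ
    refine ⟨fun x => r * χ x, contDiff_const.mul hχ, hχc.mul_left, fun x => ?_⟩
    have := (hχ1 x x.2).eq_of_nhds
    simp [this]

/-- Stone–Weierstrass: the coordinates, cut off away from `closure Ω`, separate points. -/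
theorem smoothRestrictions_dense (hΩ : Bornology.IsBounded Ω) :
    (smoothRestrictions hΩ).topologicalClosure = ⊤ := by
  refine ContinuousMap.subalgebra_topologicalClosure_eq_top_of_separatesPoints _ ?_
  intro x y hxy
  obtain ⟨i, hi⟩ : ∃ i, (x : Space d) i ≠ (y : Space d) i := by
    by_contra! h
    exact hxy (Subtype.ext (PiLp.ext h))
  obtain ⟨χ, hχ, hχc, hχ1⟩ := exists_cutoff hΩ
  have hs : ContDiff ℝ ∞ fun z : Space d => z i * χ z :=
    (EuclideanSpace.proj (𝕜 := ℝ) i : Space d →L[ℝ] ℝ).contDiff.mul hχ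
  refine ⟨_, ⟨⟨fun z => (z : Space d) i * χ z, hs.continuous.comp continuous_subtype_val⟩,
    ⟨_, hs, hχc.mul_left, fun z => rfl⟩, rfl⟩, ?_⟩
  have hx := (hχ1 x x.2).eq_of_nhds
  have hy := (hχ1 y y.2).eq_of_nhds
  simpa [hx, hy] using hi

theorem Admissible.abs_sint_le {c : ℝ → SignedMeasure (closure Ω)} {M B : ℝ}
    (h : Admissible c M B) {t : ℝ} (ht : t ∈ Icc (0 : ℝ) 1) (g : C(closure Ω, ℝ)) :
    |sint (c t) g| ≤ ‖g‖ * M := by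
  rw [← h.mass t ht]
  exact abs_sint_le_of_nonneg (h.nonneg t ht) g g.norm_coe_le_norm

/-- For smooth `G` the Hölder constant depends only on `R` and a gradient bound. A continuous `g` is
uniformly close to such a function, and the masses are bounded. -/
theorem equicontinuous_of_admissible (hΩ : Bornology.IsBounded Ω)
    {c : ℕ → ℝ → SignedMeasure (closure Ω)} {M B : ℕ → ℝ} (h : ∀ n, Admissible (c n) (M n) (B n))
    {R : ℝ} (hM : ∀ n, M n ≤ R) (hB0 : ∀ n, 0 ≤ B n) (hB : ∀ n, B n ≤ R) (g : C(closure Ω, ℝ))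
    {ε : ℝ} (hε : 0 < ε) : ∃ δ > 0, ∀ n, ∀ s ∈ Icc (0 : ℝ) 1, ∀ t ∈ Icc (0 : ℝ) 1,
      |t - s| < δ → |sint (c n t) g - sint (c n s) g| ≤ ε := by
  have hR0 : 0 ≤ R := (hB0 0).trans (hB 0)
  have hmem : g ∈ (smoothRestrictions hΩ).topologicalClosure := by
    rw [smoothRestrictions_dense]; trivial
  obtain ⟨k, ⟨G, hG, hGc, hkG⟩, hgk⟩ := Metric.mem_closure_iff.1 hmem (ε / (4 * (R + 1)))
    (by positivity)
  rw [dist_eq_norm] at hgk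
  have hgrad : Continuous (gradient G) :=
    (LinearIsometryEquiv.continuous _).comp (hG.continuous_fderiv (by simp))
  obtain ⟨L, hL⟩ := (isCompact_iff_compactSpace.2 ‹_› : IsCompact (closure Ω)).exists_bound_of_continuousOn
    hgrad.continuousOn
  have hclose : ∀ n, ∀ t ∈ Icc (0 : ℝ) 1, |sint (c n t) g - sint (c n t) k| ≤ ε / 4 := by
    intro n t ht
    rw [← sint_sub]
    refine ((h n).abs_sint_le ht _).trans ?_
    have h1 : ‖g - k‖ * M n ≤ ε / (4 * (R + 1)) * (R + 1) :=
      mul_le_mul hgk.le ((hM n).trans (by linarith)) (h n).mass_nonneg (by positivity)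
    refine h1.trans (le_of_eq ?_)
    field_simp
  have hkG' : (k : closure Ω → ℝ) = fun x : closure Ω => G x := funext hkG
  set A := 2 * R * (L ^ 2 * R) with hA
  have hA0 : 0 ≤ A := by positivity
  -- Chosen so that the squared increment is at most `(A + 1)δ = (ε/2)²`; the `+ 1` avoids dividing
  -- by zero.
  refine ⟨ε ^ 2 / 4 / (A + 1), by positivity, fun n s hs t ht hst => ?_⟩
  have hsq := sq_sint_sub_le (h n).narrow (hB0 n) (h n).nonneg
    (fun t ht => ((h n).mass t ht).le) (h n).mass_nonneg (h n).energy hG hGc hL hs ht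
  rw [← hkG'] at hsq
  have hle : 2 * B n * (L ^ 2 * M n) * |t - s| ≤ (ε / 2) ^ 2 := by
    have h1 : 2 * B n * (L ^ 2 * M n) ≤ A + 1 := by
      have : 2 * B n * (L ^ 2 * M n) ≤ A := by
        have := (h n).mass_nonneg
        have := hM n
        have := hB n
        have := hB0 n
        rw [hA]
        gcongr
      linarith
    calc 2 * B n * (L ^ 2 * M n) * |t - s| ≤ (A + 1) * (ε ^ 2 / 4 / (A + 1)) := by
          gcongr
      _ = (ε / 2) ^ 2 := by field_simp; ring
  have hk := abs_le.1 (abs_le_of_sq_le_sq (hsq.trans hle) (by positivity))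
  have h1 := abs_le.1 (hclose n t ht)
  have h2 := abs_le.1 (hclose n s hs)
  rw [abs_le]
  constructor <;> linarith [h1.1, h1.2, h2.1, h2.2, hk.1, hk.2]

/-- A diagonal extraction handles a dense sequence of times, a dense sequence of functions, and the
scalars `M n`, `B n`. Equicontinuity and the mass bound extend convergence to all times and
functions. -/
theorem exists_subseq_tendsto_of_admissible (hΩ : Bornology.IsBounded Ω)
    {c : ℕ → ℝ → SignedMeasure (closure Ω)} {M B : ℕ → ℝ} (h : ∀ n, Admissible (c n) (M n) (B n))
    {R : ℝ} (hM : ∀ n, M n ≤ R) (hB0 : ∀ n, 0 ≤ B n) (hB : ∀ n, B n ≤ R) :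
    ∃ (k : ℕ → ℕ) (M' B' : ℝ), StrictMono k ∧ Tendsto (fun n => M (k n)) atTop (𝓝 M') ∧
      Tendsto (fun n => B (k n)) atTop (𝓝 B') ∧ ∀ t ∈ Icc (0 : ℝ) 1, ∀ g : C(closure Ω, ℝ),
        ∃ l, Tendsto (fun n => sint (c (k n) t) g) atTop (𝓝 l) := by
  let e := TopologicalSpace.denseSeq (Icc (0 : ℝ) 1)
  let q := TopologicalSpace.denseSeq C(closure Ω, ℝ)
  let f : ℕ → (ℕ × ℕ) ⊕ Bool → ℝ := fun n =>
    Sum.elim (fun p => sint (c n (e p.1)) (q p.2)) fun b => if b then M n else B n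
  obtain ⟨k, a, hk, hlim⟩ := exists_subseq_tendsto_of_abs_le (f := f)
    (C := Sum.elim (fun p => ‖q p.2‖ * R) fun _ => R) <| by
      rintro n (p | b)
      · exact ((h n).abs_sint_le (e p.1).2 _).trans
          (mul_le_mul_of_nonneg_left (hM n) (norm_nonneg _))
      · cases b
        · exact (abs_of_nonneg (hB0 n)).trans_le (hB n)
        · exact (abs_of_nonneg (h n).mass_nonneg).trans_le (hM n)
  refine ⟨k, _, _, hk, hlim (Sum.inr true), hlim (Sum.inr false), fun t ht g => ?_⟩
  have hR0 : 0 ≤ R := (hB0 0).trans (hB 0)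
  refine exists_tendsto_of_approx fun ε hε => ?_
  obtain ⟨j, hj⟩ := Metric.denseRange_iff.1 (TopologicalSpace.denseRange_denseSeq _) g
    (ε / (2 * (R + 1))) (by positivity)
  obtain ⟨δ, hδ, hequi⟩ := equicontinuous_of_admissible hΩ h hM hB0 hB (q j) (half_pos hε)
  obtain ⟨i, hi⟩ := Metric.denseRange_iff.1 (TopologicalSpace.denseRange_denseSeq _)
    (⟨t, ht⟩ : Icc (0 : ℝ) 1) δ hδ
  refine ⟨fun n => sint (c (k n) (e i)) (q j), ⟨_, hlim (Sum.inl (i, j))⟩, fun n => ?_⟩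
  have h1 := abs_le.1 (hequi (k n) (e i) (e i).2 t ht hi)
  have h2 : |sint (c (k n) t) g - sint (c (k n) t) (q j)| ≤ ε / 2 := by
    rw [← sint_sub]
    refine ((h (k n)).abs_sint_le ht _).trans ?_
    rw [dist_eq_norm] at hj
    have h1 : ‖g - q j‖ * M (k n) ≤ ε / (2 * (R + 1)) * (R + 1) :=
      mul_le_mul hj.le ((hM _).trans (by linarith)) (h _).mass_nonneg (by positivity)
    refine h1.trans (le_of_eq ?_)
    field_simp
  rw [abs_le] at h2 ⊢
  constructor <;> linarith [h1.1, h1.2, h2.1, h2.2]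

/-- The limit functional is linear and positive, so Riesz–Markov–Kakutani represents it. -/
theorem exists_measure_tendsto {σ : ℕ → SignedMeasure (closure Ω)}
    (hpos : ∀ n, ∀ g : C(closure Ω, ℝ), 0 ≤ g → 0 ≤ sint (σ n) g)
    (h : ∀ g : C(closure Ω, ℝ), ∃ l, Tendsto (fun n => sint (σ n) g) atTop (𝓝 l)) :
    ∃ ν : Measure (closure Ω), IsFiniteMeasure ν ∧ ∀ g : C(closure Ω, ℝ),
      Tendsto (fun n => sint (σ n) g) atTop (𝓝 (∫ x, g x ∂ν)) := by
  choose l hl using h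
  let ℓ : C(closure Ω, ℝ) →ₗ[ℝ] ℝ :=
    { toFun := l
      map_add' := fun g g' => tendsto_nhds_unique (hl (g + g'))
        (((hl g).add (hl g')).congr fun n => (sint_add _ g g').symm)
      map_smul' := fun a g => tendsto_nhds_unique (hl (a • g))
        (((hl g).const_mul a).congr fun n => (sint_smul _ a g).symm) }
  obtain ⟨ν, hν, hint⟩ := exists_measure_integral_eq ℓ fun g hg =>
    ge_of_tendsto' (hl g) fun n => hpos n g hg
  exact ⟨ν, hν, fun g => by rw [hint g]; exact hl g⟩

/-- Compactness of sets of admissible curves with bounded mass and energy. -/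
theorem exists_limit_of_admissible (hΩ : Bornology.IsBounded Ω)
    {c : ℕ → ℝ → SignedMeasure (closure Ω)} {M B : ℕ → ℝ} (h : ∀ n, Admissible (c n) (M n) (B n))
    {R : ℝ} (hM : ∀ n, M n ≤ R) (hB0 : ∀ n, 0 ≤ B n) (hB : ∀ n, B n ≤ R) :
    ∃ (k : ℕ → ℕ) (M' B' : ℝ) (ν : ℝ → Measure (closure Ω)) (_ : ∀ t, IsFiniteMeasure (ν t)),
      StrictMono k ∧ Tendsto (fun n => M (k n)) atTop (𝓝 M') ∧
      Tendsto (fun n => B (k n)) atTop (𝓝 B') ∧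
      (∀ t ∈ Icc (0 : ℝ) 1, ∀ g : C(closure Ω, ℝ),
        Tendsto (fun n => sint (c (k n) t) g) atTop (𝓝 (sint (ν t).toSignedMeasure g))) ∧
      Admissible (fun t => (ν t).toSignedMeasure) M' B' := by
  obtain ⟨k, M', B', hk, hMk, hBk, hlim⟩ := exists_subseq_tendsto_of_admissible hΩ h hM hB0 hB
  have hex : ∀ t, ∃ ν : Measure (closure Ω), IsFiniteMeasure ν ∧ (t ∈ Icc (0 : ℝ) 1 →
      ∀ g : C(closure Ω, ℝ), Tendsto (fun n => sint (c (k n) t) g) atTop (𝓝 (∫ x, g x ∂ν))) := by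
    intro t
    by_cases ht : t ∈ Icc (0 : ℝ) 1
    · obtain ⟨ν, hν, hν'⟩ := exists_measure_tendsto (fun n => (h (k n)).nonneg t ht) (hlim t ht)
      exact ⟨ν, hν, fun _ => hν'⟩
    · exact ⟨0, inferInstance, fun ht' => absurd ht' ht⟩
  choose ν hν hνlim using hex
  have hν2 : ∀ t ∈ Icc (0 : ℝ) 1, ∀ g : C(closure Ω, ℝ),
      Tendsto (fun n => sint (c (k n) t) g) atTop (𝓝 (sint (ν t).toSignedMeasure g)) := by
    intro t ht g
    rw [sint_toSignedMeasure]
    exact hνlim t ht g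
  refine ⟨k, M', B', ν, hν, hk, hMk, hBk, hν2, ⟨fun g => ?_, fun t ht g hg => ?_,
    fun t ht => ?_, fun ψ hψ => ?_⟩⟩
  · rw [Metric.continuousOn_iff]
    intro t ht ε hε
    obtain ⟨δ, hδ, hequi⟩ := equicontinuous_of_admissible hΩ h hM hB0 hB g (half_pos hε)
    refine ⟨δ, hδ, fun s hs hst => lt_of_le_of_lt ?_ (half_lt_self hε)⟩
    exact le_of_tendsto' ((hν2 s hs g).sub (hν2 t ht g)).abs fun n => hequi _ t ht s hs hst
  · exact ge_of_tendsto' (hν2 t ht g) fun n => (h (k n)).nonneg t ht g hg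
  · exact tendsto_nhds_unique (hν2 t ht 1) (hMk.congr fun n => ((h (k n)).mass t ht).symm)
  -- For a fixed test function each term of the energy inequality converges, so the inequality
  -- survives.
  · have hconv : ∀ K : ℝ × Space d → ℝ, Continuous K → (∃ C, ∀ z, |K z| ≤ C) →
        Tendsto (fun n => ∫ t in Ioo (0 : ℝ) 1, sint (c (k n) t) (fun x => K (t, x))) atTop
          (𝓝 (∫ t in Ioo (0 : ℝ) 1, sint (ν t).toSignedMeasure (fun x => K (t, x)))) := by
      rintro K hK ⟨C, hC⟩
      let F : C(ℝ × closure Ω, ℝ) := ⟨fun p => K (p.1, p.2), by fun_prop⟩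
      refine tendsto_integral_sint (G := F.curry) (b := fun _ => max C 0)
        (fun n => (h (k n)).narrow) (fun n => (h (k n)).nonneg)
        (fun n t ht => ((h (k n)).mass t ht).le.trans (hM _)) hν2 (fun σ => ?_) ?_ ?_ ?_
      · exact ((continuous_sint σ).comp F.curry.continuous).measurable.aemeasurable
      · have : IsFiniteMeasure timeMeasure := by rw [timeMeasure]; infer_instance
        exact integrable_const _
      · exact Eventually.of_forall fun _ => le_max_right _ _
      · exact Eventually.of_forall fun t x => (hC _).trans (le_max_left _ _)
    obtain ⟨C, hC⟩ := hψ.exists_bound_spaceGrad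
    refine le_of_tendsto_of_tendsto' (hconv _ hψ.continuous_timeDeriv hψ.exists_bound_timeDeriv)
      (hBk.add ((hconv (fun z => ‖spaceGrad ψ z‖ ^ 2) (hψ.continuous_spaceGrad.norm.pow 2)
        ⟨C ^ 2, fun z => ?_⟩).const_mul (1 / 2))) fun n => (h (k n)).energy ψ hψ
    rw [abs_of_nonneg (by positivity)]
    gcongr
    exact hC z

end Compactness

/-! ### The dual variable -/

section DualVariable

theorem aemeasurable_eval_simpleFunc {β : Type*} {μ : Measure ℝ} (s : SimpleFunc ℝ β)
    {Φ : β → ℝ → ℝ} (h : ∀ x, AEMeasurable (Φ x) μ) : AEMeasurable (fun t => Φ (s t) t) μ := by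
  classical
  have h1 : (fun t => Φ (s t) t) = fun t => ∑ x ∈ s.range, (s ⁻¹' {x}).indicator (Φ x) t := by
    ext t
    rw [Finset.sum_eq_single (s t)]
    · simp
    · intro x _ hx
      simp [hx.symm]
    · intro hx
      exact absurd (s.mem_range_self t) hx
  rw [h1]
  exact Finset.aemeasurable_fun_sum _ fun x _ => (h x).indicator (s.measurableSet_fiber x)

section Sampling

variable {D : Type*} [NormedAddCommGroup D] [NormedSpace ℝ D]
  {H : ℝ → Type*} [∀ t, NormedAddCommGroup (H t)] [∀ t, InnerProductSpace ℝ (H t)]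
  {i : ∀ t, D →L[ℝ] H t}

theorem StronglyMeas.aemeasurable_inner (hi : SamplingAssumptions i) {f g : ∀ t, H t}
    (hf : StronglyMeas i f) (hg : StronglyMeas i g) :
    AEMeasurable (fun t => ⟪f t, g t⟫) timeMeasure := by
  obtain ⟨s, hs⟩ := hf
  obtain ⟨r, hr⟩ := hg
  refine aemeasurable_of_tendsto_metrizable_ae atTop
    (f := fun (n : ℕ) (t : ℝ) => ⟪i t (s n t), i t (r n t)⟫) (fun n => ?_) ?_
  · exact aemeasurable_eval_simpleFunc ((s n).pair (r n))
      (Φ := fun p t => ⟪i t p.1, i t p.2⟫) fun p => hi.measurable p.1 p.2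
  · filter_upwards [hs, hr] with t hst hrt using hst.inner hrt

theorem StronglyMeas.aemeasurable_norm (hi : SamplingAssumptions i) {f : ∀ t, H t}
    (hf : StronglyMeas i f) : AEMeasurable (fun t => ‖f t‖) timeMeasure := by
  simp_rw [norm_eq_sqrt_real_inner]
  exact (hf.aemeasurable_inner hi hf).sqrt

instance isFiniteMeasure_timeMeasure : IsFiniteMeasure timeMeasure := by
  rw [timeMeasure]; infer_instance

theorem MemL2H.integrable_norm (hi : SamplingAssumptions i) {f : ∀ t, H t} (hf : MemL2H i f) :
    Integrable (fun t => ‖f t‖) timeMeasure := by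
  refine ⟨(hf.1.aemeasurable_norm hi).aestronglyMeasurable, ?_⟩
  have h1 : ∀ t, ‖‖f t‖‖ₑ ≤ 1 + ‖f t‖ₑ ^ 2 := by
    intro t
    rw [enorm_norm]
    rcases le_total ‖f t‖ₑ 1 with h | h
    · exact h.trans le_self_add
    · refine le_trans ?_ le_add_self
      rw [sq]
      exact le_mul_of_one_le_left zero_le h
  refine (lintegral_mono h1).trans_lt ?_
  rw [lintegral_add_left measurable_const]
  exact ENNReal.add_lt_top.2 ⟨by simp, hf.2⟩

variable {d : ℕ} {Ω : Set (Space d)} [CompactSpace (closure Ω)]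
  {Kstar : ∀ t, SignedMeasure (closure Ω) →ₗ[ℝ] H t} {ρt : ℝ → SignedMeasure (closure Ω)}
  {f : ∀ t, H t}

/-- Each pairing is continuous, hence bounded, on `[0,1]`, and Banach–Steinhaus makes the bound
uniform. No sign of the curve is available here. -/
theorem NarrowlyContinuous.exists_bound (hρ : NarrowlyContinuous ρt) :
    ∃ R, 0 ≤ R ∧ ∀ t ∈ Icc (0 : ℝ) 1, ∀ g : C(closure Ω, ℝ), |sint (ρt t) g| ≤ R * ‖g‖ := by
  let F : Icc (0 : ℝ) 1 → C(closure Ω, ℝ) →L[ℝ] ℝ := fun t =>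
    (sintBilin.flip (ρt t)).mkContinuous ((ρt t).variation univ).toReal fun g => by
      rw [mul_comm]
      exact abs_sint_le _ g
  obtain ⟨R, hR⟩ := banach_steinhaus (g := F) fun g => by
    obtain ⟨K, hK⟩ := isCompact_Icc.exists_bound_of_continuousOn (hρ g)
    exact ⟨K, fun t => hK t t.2⟩
  refine ⟨R, (norm_nonneg _).trans (hR ⟨0, le_rfl, zero_le_one⟩), fun t ht g => ?_⟩
  exact (F ⟨t, ht⟩).le_of_opNorm_le (hR ⟨t, ht⟩) g

/-- The pairing with `σ` is `⟪K_t^*σ, f_t⟫ - ⟪K_t^*ρ̃_t, K_t^*σ⟫`. The last term is rewritten as the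
pairing of `ρ̃_t` with `K_t K_t^* σ`, so that the curve can be frozen in time. -/
theorem aemeasurable_sint_dualVariable (hi : SamplingAssumptions i)
    (hK : ForwardAssumptions i Kstar) (hf : MemL2H i f) (hρ : NarrowlyContinuous ρt)
    (σ : SignedMeasure (closure Ω)) :
    AEMeasurable (fun t => sint σ (dualVariable Kstar ρt f t)) timeMeasure := by
  have h1 : AEMeasurable (fun t => sint (ρt t) (preadjoint (Kstar t) (Kstar t σ)))
      timeMeasure := by
    refine hρ.aemeasurable_sint fun τ => ?_
    refine ((hK.stronglyMeas τ).aemeasurable_inner hi (hK.stronglyMeas σ)).congr ?_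
    filter_upwards [hK.weakStar_continuous] with t ht
    exact preadjoint_spec ht _ τ
  refine ((hK.stronglyMeas σ).aemeasurable_inner hi hf.1 |>.sub h1).congr ?_
  filter_upwards [hK.weakStar_continuous] with t ht
  rw [dualVariable, sint_neg, ← preadjoint_spec ht, inner_sub_right, Pi.sub_apply,
    ← preadjoint_spec ht]
  linarith [real_inner_comm (Kstar t σ) (Kstar t (ρt t)), real_inner_comm (Kstar t σ) (f t)]

theorem abs_apply_preadjoint_le {F : Type*} [NormedAddCommGroup F] [InnerProductSpace ℝ F]
    {T : SignedMeasure (closure Ω) →ₗ[ℝ] F} (hT : IsWeakStarToWeakContinuous T) {C : ℝ}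
    (hC : ∀ ρ : SignedMeasure (closure Ω), ‖T ρ‖ ≤ C * (ρ.variation univ).toReal) (h : F)
    (x : closure Ω) : |preadjoint T h x| ≤ C * ‖h‖ := by
  -- Point values are pairings with Dirac masses, whose variation is one.
  have h1 := preadjoint_spec hT h (VectorMeasure.dirac x 1)
  have h2 : sint (VectorMeasure.dirac x 1) (preadjoint T h) = preadjoint T h x := by
    simp [sint, VectorMeasure.integral_dirac' (preadjoint T h).continuous.stronglyMeasurable]
  rw [← h2, ← h1]
  refine (abs_real_inner_le_norm _ _).trans ?_
  gcongr
  simpa using hC (VectorMeasure.dirac x 1)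

theorem exists_integrable_bound_dualVariable (hi : SamplingAssumptions i)
    (hK : ForwardAssumptions i Kstar) (hf : MemL2H i f) (hρ : NarrowlyContinuous ρt) :
    ∃ b : ℝ → ℝ, Integrable b timeMeasure ∧ (∀ᵐ t ∂timeMeasure, 0 ≤ b t) ∧
      ∀ᵐ t ∂timeMeasure, ∀ x, |dualVariable Kstar ρt f t x| ≤ b t := by
  obtain ⟨C, hC⟩ := hK.bounded
  obtain ⟨R, hR0, hR⟩ := hρ.exists_bound
  refine ⟨fun t => |C| * (R * |C| + ‖f t‖),
    ((integrable_const _).add (hf.integrable_norm hi)).const_mul _,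
    Eventually.of_forall fun t => by positivity, ?_⟩
  filter_upwards [hC, hK.weakStar_continuous, ae_restrict_mem measurableSet_Ioo] with t hCt hw ht x
  have hC' : ∀ ρ : SignedMeasure (closure Ω),
      ‖Kstar t ρ‖ ≤ |C| * (ρ.variation univ).toReal := fun ρ =>
    (hCt ρ).trans (mul_le_mul_of_nonneg_right (le_abs_self C) ENNReal.toReal_nonneg)
  have h1 := abs_apply_preadjoint_le hw hC' (Kstar t (ρt t) - f t) x
  rw [dualVariable, ContinuousMap.neg_apply, abs_neg]
  refine h1.trans (mul_le_mul_of_nonneg_left ((norm_sub_le _ _).trans ?_) (abs_nonneg C))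
  gcongr
  -- The square is the pairing of `ρ̃_t` with `K_t K_t^* ρ̃_t`, so the Banach–Steinhaus bound
  -- suffices to give `‖K_t^* ρ̃_t‖ ≤ R|C|`.
  have h2 : ‖Kstar t (ρt t)‖ ^ 2 ≤ R * (|C| * ‖Kstar t (ρt t)‖) := by
    rw [← real_inner_self_eq_norm_sq, preadjoint_spec hw]
    refine (le_abs_self _).trans ((hR t (Ioo_subset_Icc_self ht) _).trans ?_)
    gcongr
    exact (ContinuousMap.norm_le _ (by positivity)).2 (abs_apply_preadjoint_le hw hC' _)
  rcases (norm_nonneg (Kstar t (ρt t))).eq_or_lt with h0 | h0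
  · rw [← h0]; positivity
  · nlinarith

end Sampling

end DualVariable

/-! ### Existence of minimizers -/

section Minimization

theorem lt_of_superlinear {φ : ℝ → ℝ≥0∞}
    (hφs : Tendsto (fun t : ℝ => φ t / ENNReal.ofReal t) atTop (𝓝 ⊤)) (K : ℝ) :
    ∃ T, 1 ≤ T ∧ ∀ t, T ≤ t → ENNReal.ofReal (K * t) < φ t := by
  have h1 := hφs.eventually (lt_mem_nhds (ENNReal.ofReal_lt_top (r := K)))
  obtain ⟨T, hT⟩ := eventually_atTop.1 h1
  refine ⟨max T 1, le_max_right _ _, fun t ht => ?_⟩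
  have h0 : 0 < t := zero_lt_one.trans_le ((le_max_right _ _).trans ht)
  have h2 := hT t ((le_max_left _ _).trans ht)
  rw [ENNReal.lt_div_iff_mul_lt (Or.inl (ENNReal.ofReal_pos.2 h0).ne')
    (Or.inl ENNReal.ofReal_ne_top)] at h2
  rwa [ENNReal.ofReal_mul' h0.le]

theorem EReal.neg_coe_add_add_coe (a : ℝ) (x : EReal) : ((-a : ℝ) : EReal) + x + a = x := by
  induction x with
  | bot => simp
  | top => simp
  | coe x => norm_cast; ring

variable {d : ℕ} {Ω : Set (Space d)}

theorem regJ_le {μ : Pairs Ω} {α β M B : ℝ} (hα : 0 < α) (hβ : 0 < β) (hM : 0 ≤ M) (hB : 0 ≤ B)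
    (hμ : ContinuityEq μ) (hE : energyB μ ≤ ENNReal.ofReal B)
    (hV : μ.1.variation univ = ENNReal.ofReal M) :
    regJ α β μ ≤ ENNReal.ofReal (β * B + α * M) := by
  rw [regJ, if_pos hμ, hV, ENNReal.ofReal_add (by positivity) (by positivity),
    ENNReal.ofReal_mul hβ.le, ENNReal.ofReal_mul hα.le]
  gcongr

theorem toReal_regJ {μ : Pairs Ω} {α β : ℝ} (hα : 0 < α) (hβ : 0 < β)
    (hμ : ContinuityEq μ) (hE : energyB μ ≠ ⊤) :
    (regJ α β μ).toReal = β * (energyB μ).toReal + α * (μ.1.variation univ).toReal := by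
  have := isFiniteMeasure_variation μ.1
  rw [regJ, if_pos hμ, ENNReal.toReal_add (ENNReal.mul_ne_top ENNReal.ofReal_ne_top hE)
    (ENNReal.mul_ne_top ENNReal.ofReal_ne_top (measure_ne_top _ _)), ENNReal.toReal_mul,
    ENNReal.toReal_mul, ENNReal.toReal_ofReal hβ.le, ENNReal.toReal_ofReal hα.le]

theorem continuityEq_of_regJ_ne_top {μ : Pairs Ω} {α β : ℝ} (hβ : 0 < β) (h : regJ α β μ ≠ ⊤) :
    ContinuityEq μ ∧ energyB μ ≠ ⊤ := by
  by_cases hμ : ContinuityEq μ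
  · refine ⟨hμ, fun hE => h ?_⟩
    rw [regJ, if_pos hμ, hE, ENNReal.mul_top (ENNReal.ofReal_pos.2 hβ).ne', top_add]
  · exact absurd (if_neg hμ) h

theorem sint_zero_left {Y : Type*} [MeasurableSpace Y] (g : Y → ℝ) :
    sint (0 : SignedMeasure Y) g = 0 :=
  VectorMeasure.integral_zero_vectorMeasure

theorem admissible_zero :
    Admissible (fun _ : ℝ => (0 : Measure (closure Ω)).toSignedMeasure) 0 0 := by
  refine ⟨fun g => continuousOn_const, fun t _ g hg => ?_, fun t _ => ?_, fun ψ _ => ?_⟩ <;>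
  simp [sint_zero_left]

variable [CompactSpace (closure Ω)]

theorem timePairing_eq {ρ : SignedMeasure (Cyl Ω)} {c : ℝ → SignedMeasure (closure Ω)}
    (hd : Disintegrates ρ c) (hc : NarrowlyContinuous c) (w : ℝ → C(closure Ω, ℝ)) :
    timePairing ρ w = ((∫ t, sint (c t) (w t) ∂timeMeasure : ℝ) : EReal) := by
  have h : ∃ c : ℝ → SignedMeasure (closure Ω), Disintegrates ρ c ∧ NarrowlyContinuous c :=
    ⟨c, hd, hc⟩
  rw [timePairing, dif_pos h]
  congr 1
  refine integral_congr_ae ?_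
  filter_upwards [ae_restrict_mem measurableSet_Ioo] with t ht
  exact h.choose_spec.1.sint_unique h.choose_spec.2 hd hc (Ioo_subset_Icc_self ht) _

/-- One half of the reduction to curves: a finite value excludes both a missing disintegration and
an infinite regularizer. -/
theorem exists_admissible_of_objective_ne_top (hΩ : Bornology.IsBounded Ω)
    {w : ℝ → C(closure Ω, ℝ)} {φ : ℝ → ℝ≥0∞} {α β : ℝ} (hα : 0 < α) (hβ : 0 < β) {μ : Pairs Ω}
    (h : objective w φ α β μ ≠ ⊤) :
    ∃ (c : ℝ → SignedMeasure (closure Ω)) (M B : ℝ), Admissible c M B ∧ 0 ≤ B ∧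
      objective w φ α β μ = ((-∫ t, sint (c t) (w t) ∂timeMeasure : ℝ) : EReal)
        + (φ (β * B + α * M) : EReal) := by
  by_cases hex : ∃ c : ℝ → SignedMeasure (closure Ω), Disintegrates μ.1 c ∧ NarrowlyContinuous c
  · obtain ⟨c, hd, hc⟩ := hex
    rw [objective, timePairing_eq hd hc w, ← EReal.coe_neg] at h ⊢
    have hJ : regJ α β μ ≠ ⊤ := by
      intro hJ
      rw [extendTop, if_pos hJ] at h
      exact h (by simp)
    obtain ⟨hμ, hE⟩ := continuityEq_of_regJ_ne_top hβ hJ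
    refine ⟨c, _, _, hμ.admissible hΩ hE hd hc, ENNReal.toReal_nonneg, ?_⟩
    rw [extendTop, if_neg hJ, toReal_regJ hα hβ hμ hE]
  · rw [objective, timePairing, dif_neg hex] at h
    refine absurd ?_ h
    rw [EReal.neg_bot]
    exact EReal.top_add_of_ne_bot (EReal.coe_ennreal_ne_bot _)

/-- The other half: the reconstructed pair may have energy below `B`, and monotonicity of `φ` makes
the inequality enough. -/
theorem exists_pair_objective_le {w : ℝ → C(closure Ω, ℝ)} {φ : ℝ → ℝ≥0∞} (hφm : Monotone φ)
    {α β : ℝ} (hα : 0 < α) (hβ : 0 < β) {ν : ℝ → Measure (closure Ω)}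
    [∀ t, IsFiniteMeasure (ν t)] {M B : ℝ}
    (h : Admissible (fun t => (ν t).toSignedMeasure) M B) (hB : 0 ≤ B) :
    ∃ μ : Pairs Ω, ContinuityEq μ ∧ Disintegrates μ.1 (fun t => (ν t).toSignedMeasure) ∧
      objective w φ α β μ ≤ ((-∫ t, sint (ν t).toSignedMeasure (w t) ∂timeMeasure : ℝ) : EReal)
        + (φ (β * B + α * M) : EReal) := by
  obtain ⟨μ, hd, hμ, hE, hV⟩ := h.exists_pair hB
  have hM := h.mass_nonneg
  refine ⟨μ, hμ, hd, ?_⟩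
  rw [objective, timePairing_eq hd h.narrow w, ← EReal.coe_neg]
  gcongr
  have hJ := regJ_le hα hβ hM hB hμ hE hV
  rw [extendTop, if_neg (ne_top_of_le_ne_top ENNReal.ofReal_ne_top hJ)]
  refine EReal.coe_ennreal_le_coe_ennreal_iff.2 (hφm ?_)
  exact ENNReal.toReal_le_of_le_ofReal (by positivity) hJ

theorem exists_minimizer (hΩ : Bornology.IsBounded Ω) {w : ℝ → C(closure Ω, ℝ)}
    (hw : ∀ σ : SignedMeasure (closure Ω), AEMeasurable (fun t => sint σ (w t)) timeMeasure)
    {b : ℝ → ℝ} (hb : Integrable b timeMeasure) (hb0 : ∀ᵐ t ∂timeMeasure, 0 ≤ b t)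
    (hwb : ∀ᵐ t ∂timeMeasure, ∀ x, |w t x| ≤ b t) {φ : ℝ → ℝ≥0∞} (hφ0 : φ 0 = 0)
    (hφm : Monotone φ) (hφl : LowerSemicontinuous φ)
    (hφs : Tendsto (fun t : ℝ => φ t / ENNReal.ofReal t) atTop (𝓝 ⊤)) {α β : ℝ} (hα : 0 < α)
    (hβ : 0 < β) :
    ∃ μ : Pairs Ω, ContinuityEq μ ∧ (∀ ν : Pairs Ω, objective w φ α β μ ≤ objective w φ α β ν) ∧
      ∃ c : ℝ → SignedMeasure (closure Ω), Disintegrates μ.1 c ∧ NarrowlyContinuous c ∧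
        ∀ t ∈ Icc (0 : ℝ) 1, 0 ≤ c t := by
  set I := sInf (range (objective w φ α β)) with hI
  -- The zero curve has value `0`, so a minimizing sequence may be assumed to stay below `1`.
  have hI1 : I < 1 := by
    obtain ⟨μ, -, -, hμ⟩ := exists_pair_objective_le (w := w) hφm hα hβ
      (ν := fun _ => (0 : Measure (closure Ω))) admissible_zero le_rfl
    refine (sInf_le (mem_range_self μ)).trans_lt (hμ.trans_lt ?_)
    simp [sint_zero_left, hφ0]
  obtain ⟨u₀, -, hu₀, hu₀m⟩ := exists_seq_tendsto_sInf
    (range_nonempty (objective (Ω := Ω) w φ α β)) (OrderBot.bddBelow _)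
  obtain ⟨N, hN⟩ := eventually_atTop.1 (hu₀.eventually (gt_mem_nhds hI1))
  set u : ℕ → EReal := fun n => u₀ (n + N) with hu
  have hulim : Tendsto u atTop (𝓝 I) := hu₀.comp (tendsto_add_atTop_nat N)
  have hu1 : ∀ n, u n < 1 := fun n => hN _ (Nat.le_add_left N n)
  have hex : ∀ n, ∃ (c : ℝ → SignedMeasure (closure Ω)) (M B : ℝ), Admissible c M B ∧ 0 ≤ B ∧
      u n = ((-∫ t, sint (c t) (w t) ∂timeMeasure : ℝ) : EReal)
        + (φ (β * B + α * M) : EReal) := by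
    intro n
    obtain ⟨μ, hμ⟩ := hu₀m (n + N)
    have h1 : objective w φ α β μ ≠ ⊤ := by
      rw [hμ]; exact (hu1 n).ne_top
    obtain ⟨c, M, B, hc, hB, heq⟩ := exists_admissible_of_objective_ne_top hΩ hα hβ h1
    exact ⟨c, M, B, hc, hB, by rw [← heq, hμ]⟩
  choose c M B hc hB0 hceq using hex
  set a : ℕ → ℝ := fun n => ∫ t, sint (c n t) (w t) ∂timeMeasure with ha
  have hφeq : ∀ n, (φ (β * B n + α * M n) : EReal) = u n + a n := fun n => by
    rw [hceq n, EReal.neg_coe_add_add_coe]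
  set W := ∫ t, b t ∂timeMeasure with hW
  have hW0 : 0 ≤ W := integral_nonneg_of_ae hb0
  have haW : ∀ n, a n ≤ W * M n := by
    intro n
    rw [hW, ← integral_mul_const]
    change (∫ t, sint (c n t) (w t) ∂timeMeasure) ≤ _
    refine (Real.le_norm_self _).trans (norm_integral_le_of_norm_le (hb.mul_const _) ?_)
    filter_upwards [ae_restrict_mem measurableSet_Ioo, hwb] with t ht h
    rw [← (hc n).mass t (Ioo_subset_Icc_self ht)]
    exact abs_sint_le_of_nonneg ((hc n).nonneg t (Ioo_subset_Icc_self ht)) (w t) h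
  -- If `J = βB + αM ≥ T ≥ 1`, this slope gives `φ(J) > J + (W/α)J ≥ 1 + WM`, whereas an objective
  -- value below `1` forces `φ(J) ≤ 1 + WM`.
  obtain ⟨T, hT1, hT⟩ := lt_of_superlinear hφs (1 + W / α)
  have hJ : ∀ n, β * B n + α * M n < T := by
    intro n
    by_contra! hTJ
    have hM0 := (hc n).mass_nonneg
    have h0 := hB0 n
    have h1 : φ (β * B n + α * M n) ≤ ENNReal.ofReal (1 + W * M n) := by
      rw [← EReal.coe_ennreal_le_coe_ennreal_iff, hφeq, EReal.coe_ennreal_ofReal,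
        max_eq_left (by positivity), EReal.coe_add]
      exact add_le_add (hu1 n).le (EReal.coe_le_coe_iff.2 (haW n))
    have h2 := (hT _ hTJ).trans_le h1
    rw [ENNReal.ofReal_lt_ofReal_iff (by positivity)] at h2
    have h3 : W * M n ≤ W / α * (β * B n + α * M n) := by
      have : W / α * (β * B n + α * M n) = W / α * (β * B n) + W * M n := by
        field_simp
      rw [this]
      have : 0 ≤ W / α * (β * B n) := by positivity
      linarith
    nlinarith
  have hMle : ∀ n, M n ≤ max (T / α) (T / β) := fun n => by
    refine le_max_of_le_left ((le_div_iff₀ hα).2 ?_)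
    have := mul_nonneg hβ.le (hB0 n)
    linarith [hJ n]
  have hBle : ∀ n, B n ≤ max (T / α) (T / β) := fun n => by
    refine le_max_of_le_right ((le_div_iff₀ hβ).2 ?_)
    have := mul_nonneg hα.le (hc n).mass_nonneg
    linarith [hJ n]
  obtain ⟨k, M', B', ν, hν, hk, hMlim, hBlim, hlim, hadm⟩ :=
    exists_limit_of_admissible hΩ hc hMle hB0 hBle
  have hB' : 0 ≤ B' := ge_of_tendsto' hBlim fun n => hB0 _
  have halim : Tendsto (fun n => a (k n)) atTop
      (𝓝 (∫ t, sint (ν t).toSignedMeasure (w t) ∂timeMeasure)) :=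
    tendsto_integral_sint (fun n => (hc (k n)).narrow) (fun n => (hc (k n)).nonneg)
      (fun n t ht => ((hc (k n)).mass t ht).le.trans (hMle _)) hlim hw hb hb0 hwb
  obtain ⟨μ, hμ, hd, hobj⟩ := exists_pair_objective_le (w := w) hφm hα hβ hadm hB'
  set a' := ∫ t, sint (ν t).toSignedMeasure (w t) ∂timeMeasure with ha'
  refine ⟨μ, hμ, fun ν' => ?_, _, hd, hadm.narrow, fun t _ =>
    Measure.zero_le_toSignedMeasure _⟩
  refine (hobj.trans ?_).trans (sInf_le (mem_range_self ν'))
  have hJlim : Tendsto (fun n => β * B (k n) + α * M (k n)) atTop (𝓝 (β * B' + α * M')) :=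
    (hBlim.const_mul β).add (hMlim.const_mul α)
  -- The objective values and the linear terms converge, so the values of `φ` do too. Finiteness of
  -- `a'` makes the sum meaningful although `I` is not yet known to exceed `⊥`.
  have hφlim : Tendsto (fun n => (φ (β * B (k n) + α * M (k n)) : EReal)) atTop
      (𝓝 (I + (a' : EReal))) := by
    simp_rw [hφeq]
    refine (EReal.continuousAt_add (p := (I, (a' : EReal)))
      (Or.inr (EReal.coe_ne_bot a')) (Or.inr (EReal.coe_ne_top a'))).tendsto.comp
      ((hulim.comp hk.tendsto_atTop).prodMk_nhds ?_)
    exact (continuous_coe_real_ereal.tendsto _).comp halim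
  have hlsc : LowerSemicontinuous fun t => (φ t : EReal) :=
    continuous_coe_ennreal_ereal.comp_lowerSemicontinuous hφl
      fun _ _ h => EReal.coe_ennreal_le_coe_ennreal_iff.2 h
  have hle : (φ (β * B' + α * M') : EReal) ≤ I + (a' : EReal) := by
    by_contra! hlt
    obtain ⟨y, hy1, hy2⟩ := exists_between hlt
    have h1 := hJlim.eventually (hlsc _ y hy2)
    exact absurd (ge_of_tendsto hφlim (h1.mono fun n hn => hn.le)) (not_le.2 hy1)
  calc ((-a' : ℝ) : EReal) + (φ (β * B' + α * M') : EReal)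
      ≤ ((-a' : ℝ) : EReal) + (I + (a' : EReal)) := by gcongr
    _ = I := by rw [← add_assoc, EReal.neg_coe_add_add_coe]

end Minimization

end OTReg

theorem mainTheorem12 {d : ℕ} (Ω : Set (OTReg.Space d)) (hΩo : IsOpen Ω)
    (hΩb : Bornology.IsBounded Ω)
    {D : Type*} [NormedAddCommGroup D] [NormedSpace ℝ D] [CompleteSpace D]
    {H : ℝ → Type*} [∀ t, NormedAddCommGroup (H t)] [∀ t, InnerProductSpace ℝ (H t)]
    [∀ t, CompleteSpace (H t)]
    (i : ∀ t, D →L[ℝ] H t) (hi : OTReg.SamplingAssumptions i)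
    (Kstar : ∀ t, SignedMeasure (closure Ω) →ₗ[ℝ] H t)
    (hK : OTReg.ForwardAssumptions i Kstar)
    (f : ∀ t, H t) (hf : OTReg.MemL2H i f)
    (α β : ℝ) (hα : 0 < α) (hβ : 0 < β)
    (ρt : ℝ → SignedMeasure (closure Ω)) (hρt : OTReg.NarrowlyContinuous ρt)
    (φ : ℝ → ℝ≥0∞) (hφ0 : φ 0 = 0) (hφm : Monotone φ) (hφl : LowerSemicontinuous φ)
    (hφs : Tendsto (fun t : ℝ => φ t / ENNReal.ofReal t) atTop (𝓝 ⊤)) :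
    ∃ μ : OTReg.Pairs Ω,
      OTReg.ContinuityEq μ ∧
      (∀ ν : OTReg.Pairs Ω,
        OTReg.objective (OTReg.dualVariable Kstar ρt f) φ α β μ
          ≤ OTReg.objective (OTReg.dualVariable Kstar ρt f) φ α β ν) ∧
      ∃ c : ℝ → SignedMeasure (closure Ω),
        OTReg.Disintegrates μ.1 c ∧ OTReg.NarrowlyContinuous c ∧
        ∀ t ∈ Icc (0 : ℝ) 1, 0 ≤ c t := by
  have := isCompact_iff_compactSpace.1 hΩb.isCompact_closure
  obtain ⟨b, hb, hb0, hwb⟩ := OTReg.exists_integrable_bound_dualVariable hi hK hf hρt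
  exact OTReg.exists_minimizer hΩb (OTReg.aemeasurable_sint_dualVariable hi hK hf hρt) hb hb0 hwb
    hφ0 hφm hφl hφs hα hβ
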